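/- Let $n,s\ge 1$ and let $M$ be a smooth manifold of dimension $2n+s$ with a Riemannian metric $g$, Levi-Civita connection $\nabla$ and curvature tensor $R_{X,Y}=[\nabla_X,\nabla_Y]-\nabla_{[X,Y]}$. A \emph{weak metric $f$-structure} on $M$ is a tuple $(f,Q,\vec\xi,\vec\eta,g)$, where $f$ is a skew-symmetric $(1,1)$-tensor of rank $2n$, $Q$ is a self-adjoint nonsingular $(1,1)$-tensor, $\xi_1,\dots,\xi_s$ are orthonormal vector fields and $\eta^1,\dots,\eta^s$ are 1-forms (all smooth), such that $$f^2=-Q+\sum_{i=1}^s\eta^i\otimes\xi_i,\qquad \eta^i(\xi_j)=\delta^i_j,\qquad Q\xi_i=\xi_i,\qquad g(fX,fY)=g(X,QY)-\sum_{i=1}^s\eta^i(X)\,\eta^i(Y).$$ It is a \emph{weak nearly $\mathcal C$-structure}, and $M$ a \emph{weak nearly $\mathcal C$-manifold}, if $(\nabla_Xf)Y+(\nabla_Yf)X=0$ for all vector fields $X,Y$. Put $\mathcal D=\bigcap_{i=1}^s\ker\eta^i$ (the contact distribution) and $\widetilde Q=Q-\mathrm{id}$. Let $(M,f,Q,\vec\xi,\vec\eta,g)$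 be a weak nearly $\mathcal C$-manifold. Then for all vector fields $X,Y,Z,V$ $$g(R_{fX,Y}Z,V)+g(R_{X,fY}Z,V)+g(R_{X,Y}fZ,V)+g(R_{X,Y}Z,fV)=0.$$ Assume moreover that $$(\nabla_XQ)Y=0\quad(X\in\mathfrak X_M,\ Y\in\mathcal D)\qquad\text{and}\qquad R_{\widetilde QX,Y}Z\in\mathcal D\quad(X,Y,Z\in\mathcal D).$$ Then (1) $g(R_{\xi_j,Z}fX,fY)=0$ for all $1\le j\le s$, all vector fields $X,Y$ and all $Z\in\mathcal D$; and $\mathcal D$ is curvature invariant, i.e. $R_{X,Y}Z\in\mathcal D$ for all $X,Y,Z\in\mathcal D$. (2) If in addition $[\xi_i,\xi_j]=0$ for all $1\le i,j\le s$ (which is automatic for $s=1$), then $R_{\xi_j,\xi_k}=0$ for all $1\le j,k\le s$, and $g(R_{\xi_j,Z}fX,fY)=0$ for all $1\le j\le s$ and all vector fields $X,Y,Z$. -/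

import Mathlib

open Bundle VectorField Module
open scoped Manifold ContDiff

noncomputable section

namespace WeakNearlyC

variable {E : Type*} [NormedAddCommGroup E] [NormedSpace ℝ E]
  {H : Type*} [TopologicalSpace H] {I : ModelWithCorners ℝ E H}
  {M : Type*} [TopologicalSpace M] [ChartedSpace H M] [IsManifold I ∞ M]

/-! ### Riemannian metrics and the Levi-Civita connection -/

/-- `g(X, Y)` is differentiable wherever the vector fields `X` and `Y` are. -/
lemma mdifferentiableAt_metric
    (g : ContMDiffRiemannianMetric I ∞ E (fun x : M ↦ TangentSpace I x))
    {X Y : Π x : M, TangentSpace I x} {x : M}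
    (hX : MDiffAt (T% X) x) (hY : MDiffAt (T% Y) x) :
    MDiffAt (fun y ↦ g.inner y (X y) (Y y)) x := by
  have h := (g.contMDiff.mdifferentiable (by simp)) x
  have : MDifferentiableAt I (I.prod 𝓘(ℝ, ℝ))
      (fun m ↦ TotalSpace.mk' ℝ (E := Bundle.Trivial M ℝ) m (g.inner m (X m) (Y m))) x :=
    MDifferentiableAt.clm_bundle_apply₂ (F₁ := E) (F₂ := E) h hX hY
  rw [mdifferentiableAt_totalSpace] at this
  exact this.2

/-- The right-hand side of the Koszul formula, i.e. the value of `g(∇_X Y, Z)` at `x`. -/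
def koszul (g : ContMDiffRiemannianMetric I ∞ E (fun x : M ↦ TangentSpace I x))
    (X Y Z : Π x : M, TangentSpace I x) (x : M) : ℝ :=
  (d% (fun y ↦ g.inner y (Y y) (Z y)) x (X x)
    + d% (fun y ↦ g.inner y (X y) (Z y)) x (Y x)
    - d% (fun y ↦ g.inner y (X y) (Y y)) x (Z x)
    + g.inner x (mlieBracket I X Y x) (Z x)
    - g.inner x (mlieBracket I X Z x) (Y x)
    - g.inner x (mlieBracket I Y Z x) (X x)) / 2

variable [FiniteDimensional ℝ E]
  (g : ContMDiffRiemannianMetric I ∞ E (fun x : M ↦ TangentSpace I x))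

lemma koszul_tensorial_left {Y Z : Π x : M, TangentSpace I x} {x : M}
    (hY : MDiffAt (T% Y) x) (hZ : MDiffAt (T% Z) x) :
    TensorialAt I E (fun X ↦ koszul g X Y Z x) x where
  smul {f X} hf hX := by
    have h1 : (fun y ↦ g.inner y ((f • X) y) (Z y)) = fun y ↦ f y * g.inner y (X y) (Z y) := by
      ext y; simp
    have h2 : (fun y ↦ g.inner y ((f • X) y) (Y y)) = fun y ↦ f y * g.inner y (X y) (Y y) := by
      ext y; simp
    simp only [koszul, h1, h2]
    rw [mvfderiv_fun_mul hf (mdifferentiableAt_metric g hX hZ),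
      mvfderiv_fun_mul hf (mdifferentiableAt_metric g hX hY),
      mlieBracket_smul_left hf hX, mlieBracket_smul_left hf hX]
    simp
    ring
  add {X X'} hX hX' := by
    have h1 : (fun y ↦ g.inner y ((X + X') y) (Z y))
        = fun y ↦ g.inner y (X y) (Z y) + g.inner y (X' y) (Z y) := by
      ext y; simp
    have h2 : (fun y ↦ g.inner y ((X + X') y) (Y y))
        = fun y ↦ g.inner y (X y) (Y y) + g.inner y (X' y) (Y y) := by
      ext y; simp
    simp only [koszul, h1, h2]
    rw [mvfderiv_fun_add (mdifferentiableAt_metric g hX hZ) (mdifferentiableAt_metric g hX' hZ),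
      mvfderiv_fun_add (mdifferentiableAt_metric g hX hY) (mdifferentiableAt_metric g hX' hY),
      mlieBracket_add_left hX hX', mlieBracket_add_left hX hX']
    simp
    ring

lemma koszul_tensorial_right {X Y : Π x : M, TangentSpace I x} {x : M}
    (hX : MDiffAt (T% X) x) (hY : MDiffAt (T% Y) x) :
    TensorialAt I E (fun Z ↦ koszul g X Y Z x) x where
  smul {f Z} hf hZ := by
    have h1 : (fun y ↦ g.inner y (X y) ((f • Z) y)) = fun y ↦ f y * g.inner y (X y) (Z y) := by
      ext y; simp
    have h2 : (fun y ↦ g.inner y (Y y) ((f • Z) y)) = fun y ↦ f y * g.inner y (Y y) (Z y) := by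
      ext y; simp
    simp only [koszul, h1, h2]
    rw [mvfderiv_fun_mul hf (mdifferentiableAt_metric g hX hZ),
      mvfderiv_fun_mul hf (mdifferentiableAt_metric g hY hZ),
      mlieBracket_smul_right hf hZ, mlieBracket_smul_right hf hZ]
    simp
    rw [g.symm x (Z x) (Y x), g.symm x (Z x) (X x)]
    ring
  add {Z Z'} hZ hZ' := by
    have h1 : (fun y ↦ g.inner y (X y) ((Z + Z') y))
        = fun y ↦ g.inner y (X y) (Z y) + g.inner y (X y) (Z' y) := by
      ext y; simp
    have h2 : (fun y ↦ g.inner y (Y y) ((Z + Z') y))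
        = fun y ↦ g.inner y (Y y) (Z y) + g.inner y (Y y) (Z' y) := by
      ext y; simp
    simp only [koszul, h1, h2]
    rw [mvfderiv_fun_add (mdifferentiableAt_metric g hX hZ) (mdifferentiableAt_metric g hX hZ'),
      mvfderiv_fun_add (mdifferentiableAt_metric g hY hZ) (mdifferentiableAt_metric g hY hZ'),
      mlieBracket_add_right hZ hZ', mlieBracket_add_right hZ hZ']
    simp
    ring

/-- The Koszul formula as a bilinear form in the values of `X` and `Z` at `x`. -/
def koszulForm {Y : Π x : M, TangentSpace I x} {x : M} (hY : MDiffAt (T% Y) x) :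
    TangentSpace I x →L[ℝ] TangentSpace I x →L[ℝ] ℝ :=
  TensorialAt.mkHom₂ (fun X Z ↦ koszul g X Y Z x) x
    (fun _ hZ ↦ koszul_tensorial_left g hY hZ)
    (fun _ hX ↦ koszul_tensorial_right g hX hY)

lemma koszulForm_apply {X Y Z : Π x : M, TangentSpace I x} {x : M} (hX : MDiffAt (T% X) x)
    (hY : MDiffAt (T% Y) x) (hZ : MDiffAt (T% Z) x) :
    koszulForm g hY (X x) (Z x) = koszul g X Y Z x :=
  TensorialAt.mkHom₂_apply _ _ hX hZ

instance (x : M) : FiniteDimensional ℝ (TangentSpace I x) :=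
  inferInstanceAs (FiniteDimensional ℝ E)

instance (x : M) : T2Space (TangentSpace I x) := inferInstanceAs (T2Space E)

lemma metric_ext {x : M} {v w : TangentSpace I x}
    (h : ∀ z, g.inner x v z = g.inner x w z) : v = w := by
  by_contra hne
  have h1 := g.pos x (v - w) (sub_ne_zero.2 hne)
  have h2 : g.inner x (v - w) (v - w) = g.inner x v (v - w) - g.inner x w (v - w) := by
    rw [map_sub (g.inner x)]; rfl
  rw [h2, h (v - w), sub_self] at h1
  exact lt_irrefl _ h1

/-- The isomorphism of `T_x M` with its dual given by the metric. -/
def flat (x : M) : TangentSpace I x ≃ₗ[ℝ] Module.Dual ℝ (TangentSpace I x) :=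
  LinearEquiv.ofInjectiveOfFinrankEq
    ((ContinuousLinearMap.coeLM ℝ).comp (g.inner x).toLinearMap)
    (fun _ _ h ↦ metric_ext g fun z ↦ congrArg (fun φ : Module.Dual ℝ (TangentSpace I x) ↦ φ z) h)
    Subspace.dual_finrank_eq.symm

lemma flat_apply (x : M) (v w : TangentSpace I x) : flat g x v w = g.inner x v w := rfl

open Classical in
/-- `∇Y` at `x`: the endomorphism `v ↦ ∇_v Y` of `T_x M` with `g(∇_v Y, w)` given by the Koszul
formula (and the value `0` where `Y` is not differentiable). -/
def nablaAt (Y : Π x : M, TangentSpace I x) (x : M) : TangentSpace I x →L[ℝ] TangentSpace I x :=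
  if hY : MDiffAt (T% Y) x then
    LinearMap.toContinuousLinearMap ((flat g x).symm.toLinearMap.comp
      ((ContinuousLinearMap.coeLM ℝ).comp (koszulForm g hY).toLinearMap))
  else 0

lemma metric_nablaAt {X Y Z : Π x : M, TangentSpace I x} {x : M} (hX : MDiffAt (T% X) x)
    (hY : MDiffAt (T% Y) x) (hZ : MDiffAt (T% Z) x) :
    g.inner x (nablaAt g Y x (X x)) (Z x) = koszul g X Y Z x := by
  rw [← koszulForm_apply g hX hY hZ, ← flat_apply]
  simp [nablaAt, hY]

lemma exists_field {x : M} (v : TangentSpace I x) :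
    ∃ X : Π x : M, TangentSpace I x, MDiffAt (T% X) x ∧ X x = v :=
  ⟨FiberBundle.extend E v, FiberBundle.mdifferentiableAt_extend I E v,
    FiberBundle.extend_apply_self E v⟩

/-- The Levi-Civita connection of `g`, as a covariant derivative on the tangent bundle.
The value `∇_X Y` at `x` is `leviCivita g Y x (X x)`. -/
def leviCivita : CovariantDerivative I E (TangentSpace I : M → Type _) where
  toFun := nablaAt g
  isCovariantDerivativeOnUniv :=
    { add := by
        intro Y Y' x hY hY' _
        ext v
        refine metric_ext g fun w ↦ ?_
        obtain ⟨X, hX, rfl⟩ := exists_field v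
        obtain ⟨Z, hZ, rfl⟩ := exists_field w
        have h : g.inner x ((nablaAt g Y x + nablaAt g Y' x) (X x)) (Z x)
            = g.inner x (nablaAt g Y x (X x)) (Z x)
              + g.inner x (nablaAt g Y' x (X x)) (Z x) := by
          simp
        rw [h, metric_nablaAt g hX hY hZ, metric_nablaAt g hX hY' hZ,
          metric_nablaAt g hX (mdifferentiableAt_add_section hY hY') hZ]
        have h1 : (fun y ↦ g.inner y ((Y + Y') y) (Z y))
            = fun y ↦ g.inner y (Y y) (Z y) + g.inner y (Y' y) (Z y) := by
          ext y; simp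
        have h2 : (fun y ↦ g.inner y (X y) ((Y + Y') y))
            = fun y ↦ g.inner y (X y) (Y y) + g.inner y (X y) (Y' y) := by
          ext y; simp
        simp only [koszul, h1, h2]
        rw [mvfderiv_fun_add (mdifferentiableAt_metric g hY hZ) (mdifferentiableAt_metric g hY' hZ),
          mvfderiv_fun_add (mdifferentiableAt_metric g hX hY) (mdifferentiableAt_metric g hX hY'),
          mlieBracket_add_right hY hY', mlieBracket_add_left hY hY']
        simp
        ring
      leibniz := by
        intro Y f x hY hf _
        ext v
        refine metric_ext g fun w ↦ ?_
        obtain ⟨X, hX, rfl⟩ := exists_field v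
        obtain ⟨Z, hZ, rfl⟩ := exists_field w
        have h : g.inner x ((f x • nablaAt g Y x + (d% f x).smulRight (Y x)) (X x)) (Z x)
            = f x * g.inner x (nablaAt g Y x (X x)) (Z x)
              + d% f x (X x) * g.inner x (Y x) (Z x) := by
          simp
        rw [h, metric_nablaAt g hX hY hZ, metric_nablaAt g hX (hf.smul_section hY) hZ]
        have h1 : (fun y ↦ g.inner y ((f • Y) y) (Z y))
            = fun y ↦ f y * g.inner y (Y y) (Z y) := by
          ext y; simp
        have h2 : (fun y ↦ g.inner y (X y) ((f • Y) y))
            = fun y ↦ f y * g.inner y (X y) (Y y) := by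
          ext y; simp
        simp only [koszul, h1, h2]
        rw [mvfderiv_fun_mul hf (mdifferentiableAt_metric g hY hZ),
          mvfderiv_fun_mul hf (mdifferentiableAt_metric g hX hY),
          mlieBracket_smul_right hf hY, mlieBracket_smul_left hf hY]
        simp
        rw [g.symm x (Y x) (X x)]
        ring }

/-- The Levi-Civita connection is torsion-free. -/
theorem leviCivita_torsion_free {X Y : Π x : M, TangentSpace I x} {x : M}
    (hX : MDiffAt (T% X) x) (hY : MDiffAt (T% Y) x) :
    leviCivita g Y x (X x) - leviCivita g X x (Y x) = mlieBracket I X Y x := by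
  refine metric_ext g fun w ↦ ?_
  obtain ⟨Z, hZ, rfl⟩ := exists_field w
  have h : g.inner x (leviCivita g Y x (X x) - leviCivita g X x (Y x)) (Z x)
      = g.inner x (nablaAt g Y x (X x)) (Z x) - g.inner x (nablaAt g X x (Y x)) (Z x) := by
    rw [map_sub (g.inner x)]; rfl
  rw [h, metric_nablaAt g hX hY hZ, metric_nablaAt g hY hX hZ]
  have h1 : (fun y ↦ g.inner y (Y y) (X y)) = fun y ↦ g.inner y (X y) (Y y) :=
    funext fun y ↦ g.symm y _ _
  have h2 : g.inner x (mlieBracket I Y X x) (Z x) = - g.inner x (mlieBracket I X Y x) (Z x) := by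
    rw [mlieBracket_swap_apply, map_neg (g.inner x)]; rfl
  simp only [koszul, h1, h2]
  ring

/-- The Levi-Civita connection is compatible with the metric. -/
theorem leviCivita_metric {X Y Z : Π x : M, TangentSpace I x} {x : M}
    (hX : MDiffAt (T% X) x) (hY : MDiffAt (T% Y) x) (hZ : MDiffAt (T% Z) x) :
    d% (fun y ↦ g.inner y (Y y) (Z y)) x (X x)
      = g.inner x (leviCivita g Y x (X x)) (Z x) + g.inner x (Y x) (leviCivita g Z x (X x)) := by
  have h : g.inner x (Y x) (leviCivita g Z x (X x)) = koszul g X Z Y x := by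
    rw [g.symm]; exact metric_nablaAt g hX hZ hY
  have h' : g.inner x (leviCivita g Y x (X x)) (Z x) = koszul g X Y Z x :=
    metric_nablaAt g hX hY hZ
  have h1 : (fun y ↦ g.inner y (Z y) (Y y)) = fun y ↦ g.inner y (Y y) (Z y) :=
    funext fun y ↦ g.symm y _ _
  have h2 : g.inner x (mlieBracket I Z Y x) (X x) = - g.inner x (mlieBracket I Y Z x) (X x) := by
    rw [mlieBracket_swap_apply, map_neg (g.inner x)]; rfl
  rw [h, h']
  simp only [koszul, h1, h2]
  ring

/-- The vector field `∇_X Y`. -/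
def nabla (X Y : Π x : M, TangentSpace I x) : Π x : M, TangentSpace I x :=
  fun x ↦ leviCivita g Y x (X x)

/-- The curvature `R_{X,Y} Z = ∇_X ∇_Y Z - ∇_Y ∇_X Z - ∇_{[X,Y]} Z`. -/
def curvature (X Y Z : Π x : M, TangentSpace I x) : Π x : M, TangentSpace I x :=
  nabla g X (nabla g Y Z) - nabla g Y (nabla g X Z) - nabla g (mlieBracket I X Y) Z

/-! ### Smooth fields, and weak nearly `C`-structures -/

variable (I M) in
/-- A `(1,1)`-tensor field: an endomorphism of every tangent space. -/
abbrev EndField := Π x : M, TangentSpace I x →L[ℝ] TangentSpace I x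

/-- The vector field `X` is smooth. -/
def SmoothField (X : Π x : M, TangentSpace I x) : Prop :=
  ContMDiff I (I.prod 𝓘(ℝ, E)) ∞ (fun x ↦ TotalSpace.mk' E x (X x))

/-- The `(1,1)`-tensor field `T` is smooth. -/
def SmoothEndField (T : EndField I M) : Prop :=
  ContMDiff I (I.prod 𝓘(ℝ, E →L[ℝ] E)) ∞
    (fun x ↦ TotalSpace.mk' (E →L[ℝ] E)
      (E := fun x : M ↦ TangentSpace I x →L[ℝ] TangentSpace I x) x (T x))

/-- The 1-form `η` is smooth. -/
def SmoothForm (η : Π x : M, TangentSpace I x →L[ℝ] ℝ) : Prop :=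
  ContMDiff I (I.prod 𝓘(ℝ, E →L[ℝ] ℝ)) ∞
    (fun x ↦ TotalSpace.mk' (E →L[ℝ] ℝ)
      (E := fun x : M ↦ TangentSpace I x →L[ℝ] Bundle.Trivial M ℝ x) x (η x))

/-- The vector field `T X`. -/
def EndField.app (T : EndField I M) (X : Π x : M, TangentSpace I x) : Π x : M, TangentSpace I x :=
  fun x ↦ T x (X x)

/-- The covariant derivative `(∇_X T) Y = ∇_X (T Y) - T (∇_X Y)` of a `(1,1)`-tensor field. -/
def nablaEnd (T : EndField I M) (X Y : Π x : M, TangentSpace I x) : Π x : M, TangentSpace I x :=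
  nabla g X (T.app Y) - T.app (nabla g X Y)

/-- A weak metric `f`-structure `(f, Q, ξ, η, g)` on a manifold `M` of dimension `2n + s`. -/
structure IsWeakMetricFStructure (n s : ℕ) (f Q : EndField I M)
    (ξ : Fin s → Π x : M, TangentSpace I x) (η : Fin s → Π x : M, TangentSpace I x →L[ℝ] ℝ) :
    Prop where
  n_pos : 0 < n
  s_pos : 0 < s
  dim : finrank ℝ E = 2 * n + s
  smooth_f : SmoothEndField f
  smooth_Q : SmoothEndField Q
  smooth_ξ : ∀ i, SmoothField (ξ i)
  smooth_η : ∀ i, SmoothForm (η i)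
  skew_f : ∀ (x : M) (v w : TangentSpace I x), g.inner x (f x v) w = - g.inner x v (f x w)
  rank_f : ∀ x : M, finrank ℝ (LinearMap.range (f x).toLinearMap) = 2 * n
  selfAdjoint_Q : ∀ (x : M) (v w : TangentSpace I x), g.inner x (Q x v) w = g.inner x v (Q x w)
  nonsingular_Q : ∀ x : M, Function.Bijective (Q x)
  orthonormal_ξ : ∀ (x : M) (i j : Fin s), g.inner x (ξ i x) (ξ j x) = if i = j then 1 else 0
  f_sq : ∀ (x : M) (v : TangentSpace I x), f x (f x v) = - Q x v + ∑ i, η i x v • ξ i x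
  η_ξ : ∀ (x : M) (i j : Fin s), η i x (ξ j x) = if i = j then 1 else 0
  Q_ξ : ∀ (x : M) (i : Fin s), Q x (ξ i x) = ξ i x
  metric_f : ∀ (x : M) (v w : TangentSpace I x),
    g.inner x (f x v) (f x w) = g.inner x v (Q x w) - ∑ i, η i x v * η i x w

/-- A weak nearly `C`-structure: a weak metric `f`-structure with
`(∇_X f) Y + (∇_Y f) X = 0` for all smooth vector fields `X`, `Y`. -/
structure IsWeakNearlyC (n s : ℕ) (f Q : EndField I M)
    (ξ : Fin s → Π x : M, TangentSpace I x) (η : Fin s → Π x : M, TangentSpace I x →L[ℝ] ℝ) :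
    Prop extends IsWeakMetricFStructure g n s f Q ξ η where
  nearly : ∀ X Y : Π x : M, TangentSpace I x, SmoothField X → SmoothField Y →
    nablaEnd g f X Y + nablaEnd g f Y X = 0

/-- `X` is a section of the contact distribution `D`, the common kernel of the forms `η i`. -/
def InContact {s : ℕ} (η : Fin s → Π x : M, TangentSpace I x →L[ℝ] ℝ)
    (X : Π x : M, TangentSpace I x) : Prop :=
  ∀ (x : M) (i : Fin s), η i x (X x) = 0

/-- `(∇_X Q) Y = 0` for all `X` and all `Y` in the contact distribution. -/
def QParallelOnContact {s : ℕ} (Q : EndField I M)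
    (η : Fin s → Π x : M, TangentSpace I x →L[ℝ] ℝ) : Prop :=
  ∀ X Y : Π x : M, TangentSpace I x, SmoothField X → SmoothField Y → InContact η Y →
    nablaEnd g Q X Y = 0

/-- With `Q̃ = Q - id`: `R_{Q̃X,Y} Z` lies in the contact distribution whenever
`X`, `Y`, `Z` do. -/
def QCurvatureInvariant {s : ℕ} (Q : EndField I M)
    (η : Fin s → Π x : M, TangentSpace I x →L[ℝ] ℝ) : Prop :=
  ∀ X Y Z : Π x : M, TangentSpace I x, SmoothField X → SmoothField Y → SmoothField Z →
    InContact η X → InContact η Y → InContact η Z →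
    InContact η (curvature g (Q.app X - X) Y Z)

/-- The contact distribution is curvature invariant: `R_{X,Y} Z` lies in it whenever
`X`, `Y`, `Z` do. -/
def ContactCurvatureInvariant {s : ℕ} (η : Fin s → Π x : M, TangentSpace I x →L[ℝ] ℝ) : Prop :=
  ∀ X Y Z : Π x : M, TangentSpace I x, SmoothField X → SmoothField Y → SmoothField Z →
    InContact η X → InContact η Y → InContact η Z → InContact η (curvature g X Y Z)

end WeakNearlyC

end

/-!
Write `A · R` for the covariant tensor obtained by letting a skew endomorphism `A` act on the
curvature tensor `R` as a derivation. By the Ricci identity and the pair symmetry of `R`, it is a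
sum of four values of `∇²A`. If `∇A` is skew in all its arguments, this sum is invariant under
cyclic permutations of the first three arguments, while the Bianchi identity makes the cyclic sum
vanish; hence `f · R = 0`.

On the contact distribution, the hypothesis on `R_{Q̃X,Y}Z` says that `f²` acts as `-1` in each
argument of `T(X, Y, Z) = g(R_{X,Y}Z, ξ i)`. Since `f · T = 0`, this gives
`T(X, Y, Z) = 2 T(fX, fY, Z)`, and applying it twice gives `T = 4 T`.

Let now the fields `ξ i` commute and `Q` be parallel. Then `∇_{ξ i} ξ j = 0`, so the curvature
`R_{ξ i,ξ j}` is the commutator `[∇_{ξ i}, ∇_{ξ j}]`, and the endomorphisms `c i = f² ∇ξ i` are skew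
and anticommute with `f`. Since `f · R = 0` and `f (ξ i) = 0`, the endomorphisms `R_{ξ i,·} ξ j`
commute with `f`, and so do the `[∇_{ξ i}, c j]`; differentiating `c j f + f c j = 0` then gives
`[∇_{ξ i}, c j] = ½ [c i, c j]` and `R_{ξ i,ξ j} = -2 [c i, c j]`. The Jacobi identity for
`∇_{ξ i}`, `∇_{ξ j}`, `c k` turns these into `-2 [[c i, c j], c k] = ¼ [[c i, c j], c k]`. For skew
endomorphisms `a`, `b` of a Euclidean space, `[[a, b], a] = 0` makes the trace of `[a, b]²` vanish,
and hence the skew endomorphism `[a, b]` itself.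
-/

noncomputable section

namespace WeakNearlyC

/-! ### Linear algebra -/

lemma eq_zero_of_derivation_of_sq {𝕜 S C : Type*} [Field 𝕜] [CharZero 𝕜] [AddCommGroup C]
    [Module 𝕜 C]
    {T : S → S → S → C} {J : S → S}
    (hder : ∀ x y z, T (J x) y z + T x (J y) z + T x y (J z) = 0)
    (h₁ : ∀ x y z, T (J (J x)) y z = -T x y z) (h₂ : ∀ x y z, T x (J (J y)) z = -T x y z)
    (h₃ : ∀ x y z, T x y (J (J z)) = -T x y z) (x y z : S) : T x y z = 0 := by
  have double : ∀ x y, T x y z = (2 : 𝕜) • T (J x) (J y) z := fun x y ↦ by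
    have hx := hder (J x) y z
    have hy := hder x (J y) z
    have hz := hder x y (J z)
    rw [h₁] at hx
    rw [h₂] at hy
    rw [h₃] at hz
    linear_combination (norm := module) hz - hx - hy
  have hJ := double (J x) (J y)
  rw [h₁, h₂, neg_neg] at hJ
  linear_combination (norm := module) (-1 / 3 : 𝕜) • (double x y + (2 : 𝕜) • hJ)

lemma lie_lie_lie_eq_zero {𝕜 𝔤 ι : Type*} [Field 𝕜] [CharZero 𝕜] [LieRing 𝔤]
    [LieAlgebra 𝕜 𝔤] {N c : ι → 𝔤}
    (hc : ∀ i j, ⁅N i, c j⁆ = (1 / 2 : 𝕜) • ⁅c i, c j⁆)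
    (hN : ∀ i j, ⁅N i, N j⁆ = (-2 : 𝕜) • ⁅c i, c j⁆) (i j k : ι) : ⁅⁅c i, c j⁆, c k⁆ = 0 := by
  have hNcc : ∀ i j, ⁅N i, ⁅c j, c k⁆⁆ = (1 / 2 : 𝕜) • ⁅c i, ⁅c j, c k⁆⁆ := fun i j ↦ by
    rw [leibniz_lie, hc, hc, leibniz_lie (c i), smul_lie, lie_smul, smul_add]
  have h₁ : ⁅⁅N i, N j⁆, c k⁆ = (1 / 4 : 𝕜) • ⁅⁅c i, c j⁆, c k⁆ := by
    rw [lie_lie, hc, hc, lie_smul, lie_smul, hNcc, hNcc, lie_lie (c i)]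
    module
  have h₂ : ⁅⁅N i, N j⁆, c k⁆ = (-2 : 𝕜) • ⁅⁅c i, c j⁆, c k⁆ := by rw [hN, smul_lie]
  linear_combination (norm := module) (4 / 9 : 𝕜) • (h₂ - h₁)

lemma lie_eq_zero_of_lie_lie_eq_zero {𝕜 V : Type*} [RCLike 𝕜] [NormedAddCommGroup V]
    [InnerProductSpace 𝕜 V] [FiniteDimensional 𝕜 V] {a b : Module.End 𝕜 V}
    (ha : LinearMap.adjoint a = -a) (hb : LinearMap.adjoint b = -b) (hab : ⁅⁅a, b⁆, a⁆ = 0) :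
    ⁅a, b⁆ = 0 := by
  have hadj : LinearMap.adjoint ⁅a, b⁆ = -⁅a, b⁆ := by
    simp only [Ring.lie_def, map_sub, Module.End.mul_eq_comp, LinearMap.adjoint_comp, ha, hb]
    simp only [← Module.End.mul_eq_comp, neg_mul_neg, neg_sub]
  have htr : LinearMap.trace 𝕜 V (⁅a, b⁆ * ⁅a, b⁆) = 0 := by
    have : ⁅a, b⁆ * ⁅a, b⁆ = ⁅a, b * ⁅a, b⁆⁆ + b * ⁅⁅a, b⁆, a⁆ := by
      simp only [Ring.lie_def]
      noncomm_ring
    rw [this, hab, mul_zero, add_zero, Ring.lie_def, map_sub, LinearMap.trace_mul_comm, sub_self]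
  have hnorm : ∑ i, ((‖⁅a, b⁆ (stdOrthonormalBasis 𝕜 V i)‖ ^ 2 : ℝ) : 𝕜) = 0 := by
    rw [LinearMap.trace_eq_sum_inner _ (stdOrthonormalBasis 𝕜 V), ← neg_eq_zero,
      ← Finset.sum_neg_distrib] at htr
    rw [← htr]
    refine Finset.sum_congr rfl fun i _ ↦ ?_
    rw [Module.End.mul_apply, ← LinearMap.adjoint_inner_left, hadj, LinearMap.neg_apply,
      inner_neg_left, neg_neg, inner_self_eq_norm_sq_to_K, RCLike.ofReal_pow]
  rw [← RCLike.ofReal_sum, RCLike.ofReal_eq_zero,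
    Finset.sum_eq_zero_iff_of_nonneg fun _ _ ↦ sq_nonneg _] at hnorm
  refine (stdOrthonormalBasis 𝕜 V).toBasis.ext fun i ↦ ?_
  simpa using hnorm i (Finset.mem_univ i)

/-! ### The curvature of a Levi-Civita connection -/

/-- An algebraic model of the Levi-Civita connection of a Riemannian manifold: `V` plays the role
of the smooth vector fields and `C` that of the smooth functions. The Lie bracket of `X` and `Y` is
encoded as `con X Y - con Y X`, so that the connection is torsion-free by construction. The fields
`met`, `der` and `con` stand for the metric, the action of vector fields on functions and `∇`. -/
structure LeviCivitaModel (𝕜 V C : Type*) [Field 𝕜] [AddCommGroup V] [Module 𝕜 V]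
    [AddCommGroup C] [Module 𝕜 C] where
  met : V →ₗ[𝕜] V →ₗ[𝕜] C
  der : V → C →ₗ[𝕜] C
  con : V →ₗ[𝕜] Module.End 𝕜 V
  met_symm : ∀ X Y, met X Y = met Y X
  met_definite : ∀ X, met X X = 0 → X = 0
  der_met : ∀ X Y Z, der X (met Y Z) = met (con X Y) Z + met Y (con X Z)
  der_bracket : ∀ X Y c, der (con X Y - con Y X) c = der X (der Y c) - der Y (der X c)
  jacobi : ∀ X Y Z, con X (con Y Z - con Z Y) - con (con Y Z - con Z Y) X
    = con (con X Y - con Y X) Z - con Z (con X Y - con Y X)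
      + (con Y (con X Z - con Z X) - con (con X Z - con Z X) Y)

namespace LeviCivitaModel

variable {𝕜 V C : Type*} [Field 𝕜] [AddCommGroup V] [Module 𝕜 V] [AddCommGroup C]
  [Module 𝕜 C] (L : LeviCivitaModel 𝕜 V C)

variable {L} in
lemma ext_met {X Y : V} (h : ∀ Z, L.met X Z = L.met Y Z) : X = Y :=
  sub_eq_zero.1 <| L.met_definite _ <| by simp only [map_sub, LinearMap.sub_apply, h, sub_self]

/-- The curvature operator `R_{X,Y}`. -/
def curv (X Y : V) : Module.End 𝕜 V :=
  ⁅L.con X, L.con Y⁆ - L.con (L.con X Y - L.con Y X)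

lemma curv_apply (X Y Z : V) : L.curv X Y Z
    = L.con X (L.con Y Z) - L.con Y (L.con X Z) - L.con (L.con X Y - L.con Y X) Z := rfl

lemma curv_sub_left (X X' Y : V) : L.curv (X - X') Y = L.curv X Y - L.curv X' Y := by
  ext Z
  simp only [curv_apply, map_sub, LinearMap.sub_apply]
  abel

lemma curv_zero_left (Y : V) : L.curv 0 Y = 0 := by
  simpa only [sub_self] using L.curv_sub_left 0 0 Y

lemma curv_neg_left (X Y : V) : L.curv (-X) Y = -L.curv X Y := by
  simpa only [zero_sub, curv_zero_left] using L.curv_sub_left 0 X Y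

lemma curv_swap (X Y : V) : L.curv X Y = -L.curv Y X := by
  ext Z
  simp only [curv_apply, map_sub, LinearMap.sub_apply, LinearMap.neg_apply]
  abel

lemma bianchi (X Y Z : V) : L.curv X Y Z + L.curv Y Z X + L.curv Z X Y = 0 := by
  have h := L.jacobi X Y Z
  simp only [curv_apply, map_sub, LinearMap.sub_apply] at h ⊢
  linear_combination (norm := module) h

lemma met_bianchi (X Y Z W : V) :
    L.met (L.curv X Y Z) W + L.met (L.curv Y Z X) W + L.met (L.curv Z X Y) W = 0 := by
  simpa using congrArg (fun U ↦ L.met U W) (L.bianchi X Y Z)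

lemma met_curv_swap (X Y Z W : V) : L.met (L.curv X Y Z) W = -L.met (L.curv Y X Z) W := by
  rw [L.curv_swap, LinearMap.neg_apply, map_neg, LinearMap.neg_apply]

lemma met_curv_skew (X Y Z W : V) : L.met (L.curv X Y Z) W = -L.met (L.curv X Y W) Z := by
  have hXY := L.der_bracket X Y (L.met Z W)
  simp only [L.der_met, map_add] at hXY
  simp only [curv_apply, map_sub, LinearMap.sub_apply, L.met_symm _ Z] at hXY ⊢
  linear_combination (norm := module) -hXY

lemma met_curv_pair_symm [CharZero 𝕜] (X Y Z W : V) :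
    L.met (L.curv X Y Z) W = L.met (L.curv Z W X) Y := by
  have h₁ := L.met_bianchi X Y Z W
  have h₂ := L.met_bianchi Y Z W X
  have h₃ := L.met_bianchi Z W X Y
  have h₄ := L.met_bianchi W X Y Z
  rw [L.met_curv_skew Y Z W X, L.met_curv_skew Z W Y X, L.met_curv_swap W Y Z X,
    L.met_curv_skew Y W Z X, L.met_curv_swap Y W X Z] at h₂
  rw [L.met_curv_skew X Z W Y, L.met_curv_swap X Z Y W, L.met_curv_skew W X Z Y] at h₃
  rw [L.met_curv_skew X Y W Z, L.met_curv_swap Y W X Z] at h₄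
  linear_combination (norm := module) (1 / 2 : 𝕜) • (h₁ + h₂ - h₃ - h₄)

/-! ### Covariant derivatives of endomorphisms -/

variable {L} {A : Module.End 𝕜 V}

lemma met_apply_of_isSkewAdjoint (hA : L.met.IsSkewAdjoint A) (X Y : V) :
    L.met (A X) Y = -L.met X (A Y) :=
  (hA X Y).trans (map_neg _ _)

lemma isSkewAdjoint_con_lie (hA : L.met.IsSkewAdjoint A) (X : V) :
    L.met.IsSkewAdjoint (⁅L.con X, A⁆ : Module.End 𝕜 V) := by
  intro Y Z
  have h₁ := L.der_met X (A Y) Z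
  have h₂ := L.der_met X Y (A Z)
  simp only [met_apply_of_isSkewAdjoint hA, map_neg] at h₁
  simp only [Ring.lie_def, LinearMap.sub_apply, Module.End.mul_apply, Pi.neg_apply, map_sub,
    map_neg, met_apply_of_isSkewAdjoint hA]
  linear_combination (norm := module) -h₁ - h₂

lemma isSelfAdjoint_con_lie (hA : L.met.IsSelfAdjoint A) (X : V) :
    L.met.IsSelfAdjoint (⁅L.con X, A⁆ : Module.End 𝕜 V) := by
  intro Y Z
  have h₁ := L.der_met X (A Y) Z
  have h₂ := L.der_met X Y (A Z)
  rw [hA Y Z, hA Y (L.con X Z)] at h₁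
  simp only [Ring.lie_def, LinearMap.sub_apply, Module.End.mul_apply, map_sub, hA (L.con X Y) Z]
  linear_combination (norm := module) h₂ - h₁

variable (L) in
/-- The second covariant derivative `∇²_{W,X} A` of an endomorphism `A`, whose first covariant
derivative `∇_X A` is the commutator `⁅L.con X, A⁆`. -/
def secondDeriv (A : Module.End 𝕜 V) (W X : V) : Module.End 𝕜 V :=
  ⁅L.con W, ⁅L.con X, A⁆⁆ - ⁅L.con (L.con W X), A⁆

variable (L) in
lemma secondDeriv_sub_secondDeriv (A : Module.End 𝕜 V) (W X : V) :
    L.secondDeriv A W X - L.secondDeriv A X W = ⁅L.curv W X, A⁆ := by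
  simp only [secondDeriv, curv, Ring.lie_def, map_sub]
  noncomm_ring

variable (hA : L.met.IsSkewAdjoint A)
  (hnearly : ∀ X Y, (⁅L.con X, A⁆ : Module.End 𝕜 V) Y = -(⁅L.con Y, A⁆ : Module.End 𝕜 V) X)

include hA in
lemma met_secondDeriv_skew (W X Y Z : V) :
    L.met (L.secondDeriv A W X Y) Z = -L.met (L.secondDeriv A W X Z) Y := by
  have h₁ := met_apply_of_isSkewAdjoint (isSkewAdjoint_con_lie (isSkewAdjoint_con_lie hA X) W) Y Z
  have h₂ := met_apply_of_isSkewAdjoint (isSkewAdjoint_con_lie hA (L.con W X)) Y Z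
  rw [L.met_symm Y] at h₁ h₂
  simp only [secondDeriv, map_sub, LinearMap.sub_apply, h₁, h₂]
  abel

include hnearly in
lemma secondDeriv_swap (W X Y : V) : L.secondDeriv A W X Y = -L.secondDeriv A W Y X := by
  simp only [secondDeriv, LinearMap.sub_apply, Ring.lie_def (L.con W), Module.End.mul_apply]
  rw [hnearly X Y, hnearly (L.con W X) Y, hnearly (L.con W Y) X, map_neg]
  abel

variable (L A) in
/-- The covariant `4`-tensor `A · R`, where `A` acts on the curvature tensor `R` as a derivation
(up to sign). -/
def derivCurv (X Y Z W : V) : C :=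
  L.met (L.curv (A X) Y Z) W + L.met (L.curv X (A Y) Z) W + L.met (L.curv X Y (A Z)) W
    + L.met (L.curv X Y Z) (A W)

variable (L A) in
lemma derivCurv_bianchi (X Y Z W : V) :
    L.derivCurv A X Y Z W + L.derivCurv A Y Z X W + L.derivCurv A Z X Y W = 0 := by
  simp only [derivCurv]
  linear_combination (norm := module) L.met_bianchi (A X) Y Z W + L.met_bianchi X (A Y) Z W
    + L.met_bianchi X Y (A Z) W + L.met_bianchi X Y Z (A W)

include hA in
lemma met_curv_apply_add_met_curv_apply (X Y Z W : V) :
    L.met (L.curv X Y (A Z)) W + L.met (L.curv X Y Z) (A W)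
      = L.met (L.secondDeriv A X Y Z) W - L.met (L.secondDeriv A Y X Z) W := by
  have ricci := congrArg (fun B : Module.End 𝕜 V ↦ L.met (B Z) W)
    (L.secondDeriv_sub_secondDeriv A X Y)
  simp only [Ring.lie_def, LinearMap.sub_apply, Module.End.mul_apply, map_sub,
    met_apply_of_isSkewAdjoint hA] at ricci
  rw [ricci, sub_neg_eq_add]

include hA in
lemma derivCurv_eq [CharZero 𝕜] (X Y Z W : V) :
    L.derivCurv A X Y Z W = L.met (L.secondDeriv A X Y Z) W - L.met (L.secondDeriv A Y X Z) W
      + L.met (L.secondDeriv A Z W X) Y - L.met (L.secondDeriv A W Z X) Y := by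
  have hXY := met_curv_apply_add_met_curv_apply hA X Y Z W
  have hZW := met_curv_apply_add_met_curv_apply hA Z W X Y
  rw [L.met_curv_pair_symm Z W (A X) Y, L.met_curv_pair_symm Z W X (A Y)] at hZW
  rw [derivCurv]
  linear_combination (norm := module) hXY + hZW

include hA hnearly in
lemma derivCurv_rotate [CharZero 𝕜] (X Y Z W : V) :
    L.derivCurv A Y Z X W = L.derivCurv A X Y Z W := by
  have skew := met_secondDeriv_skew hA
  have swap : ∀ W X Y Z, L.met (L.secondDeriv A W X Y) Z = -L.met (L.secondDeriv A W Y X) Z :=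
    fun W X Y Z ↦ by
      rw [secondDeriv_swap hnearly, map_neg, LinearMap.neg_apply]
  simp only [derivCurv_eq hA]
  linear_combination (norm := module) swap Y Z X W - swap Z Y X W + swap X W Y Z
    - skew X Y W Z - skew W X Y Z + swap W X Z Y - swap Z W X Y + skew Z X W Y

include hA hnearly in
theorem derivCurv_eq_zero [CharZero 𝕜] (X Y Z W : V) : L.derivCurv A X Y Z W = 0 := by
  have h := L.derivCurv_bianchi A X Y Z W
  rw [← derivCurv_rotate hA hnearly Z X Y, derivCurv_rotate hA hnearly X Y Z] at h
  linear_combination (norm := module) (1 / 3 : 𝕜) • h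

end LeviCivitaModel

/-! ### Weak nearly `C`-structures on an algebraic model -/

lemma LeviCivitaModel.mul_eq_zero_of_isAdjointPair {𝕜 V C : Type*} [Field 𝕜] [AddCommGroup V]
    [Module 𝕜 V] [AddCommGroup C] [Module 𝕜 C] {L : LeviCivitaModel 𝕜 V C}
    {A A' B B' : Module.End 𝕜 V}
    (hA : LinearMap.IsAdjointPair L.met L.met A A') (hB : LinearMap.IsAdjointPair L.met L.met B B')
    (hAB : A * B = 0) : B' * A' = 0 := by
  refine LinearMap.ext fun X ↦ LeviCivitaModel.ext_met (L := L) fun Z ↦ ?_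
  rw [L.met_symm, ← (hA.mul hB) Z X, hAB]
  simp only [LinearMap.zero_apply, map_zero]

/-- An algebraic model of a weak nearly `C`-structure on a `LeviCivitaModel`: `F` and `Q` stand for
the tensors `f` and `Q`, and `P` for the orthogonal projection `∑ i, η i ⊗ ξ i` onto the span of
the fields `ξ i`, so that `P X = 0` says that `X` is a section of the contact distribution. -/
structure WeakNearlyCModel {𝕜 V C : Type*} [Field 𝕜] [AddCommGroup V] [Module 𝕜 V] [AddCommGroup C]
    [Module 𝕜 C] (L : LeviCivitaModel 𝕜 V C) {ι : Type*} (F Q P : Module.End 𝕜 V) (ξ : ι → V) :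
    Prop where
  isSkewAdjoint_F : L.met.IsSkewAdjoint F
  nearly : ∀ X Y, (⁅L.con X, F⁆ : Module.End 𝕜 V) Y = -(⁅L.con Y, F⁆ : Module.End 𝕜 V) X
  isSelfAdjoint_Q : L.met.IsSelfAdjoint Q
  injective_Q : Function.Injective Q
  F_mul_F : F * F = P - Q
  F_mul_P : F * P = 0
  Q_mul_P : Q * P = P
  P_ξ : ∀ i, P (ξ i) = ξ i
  P_eq_zero_iff : ∀ X, P X = 0 ↔ ∀ i, L.met X (ξ i) = 0
  der_met_ξ : ∀ X i j, L.der X (L.met (ξ i) (ξ j)) = 0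

namespace WeakNearlyCModel

open LeviCivitaModel

variable {𝕜 V C : Type*} [Field 𝕜] [AddCommGroup V] [Module 𝕜 V] [AddCommGroup C]
  [Module 𝕜 C] {L : LeviCivitaModel 𝕜 V C} {ι : Type*} {F Q P : Module.End 𝕜 V} {ξ : ι → V}
  (h : WeakNearlyCModel L F Q P ξ)

include h

lemma P_eq : P = F * F + Q := by rw [h.F_mul_F, sub_add_cancel]

lemma isSelfAdjoint_P : L.met.IsSelfAdjoint P := by
  have hFF : L.met.IsSelfAdjoint (F * F : Module.End 𝕜 V) := fun X Y ↦ by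
    simp only [Module.End.mul_apply, met_apply_of_isSkewAdjoint h.isSkewAdjoint_F, neg_neg]
  intro X Y
  simp only [h.P_eq, LinearMap.add_apply, map_add, hFF X Y, h.isSelfAdjoint_Q X Y]

lemma P_mul_F : P * F = 0 := by
  have := mul_eq_zero_of_isAdjointPair (A' := -F) h.isSkewAdjoint_F h.isSelfAdjoint_P h.F_mul_P
  rwa [mul_neg, neg_eq_zero] at this

lemma P_mul_P : P * P = P := by
  rw [h.P_eq, add_mul, ← h.P_eq, mul_assoc, h.F_mul_P, mul_zero, zero_add, h.Q_mul_P]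

lemma P_mul_Q : P * Q = P := by
  have hPFF : P * (F * F) = 0 := by rw [← mul_assoc, h.P_mul_F, zero_mul]
  rw [h.F_mul_F, mul_sub, h.P_mul_P, sub_eq_zero] at hPFF
  exact hPFF.symm

lemma P_F_apply (X : V) : P (F X) = 0 := DFunLike.congr_fun h.P_mul_F X

lemma F_ξ (i : ι) : F (ξ i) = 0 := by
  rw [← h.P_ξ i]; exact DFunLike.congr_fun h.F_mul_P (ξ i)

lemma Q_ξ (i : ι) : Q (ξ i) = ξ i := by
  rw [← h.P_ξ i]; exact DFunLike.congr_fun h.Q_mul_P (ξ i)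

lemma eq_P_mul_of_F_mul_eq_zero {A : Module.End 𝕜 V} (hA : F * A = 0) : A = P * A := by
  have hQA : Q * A = Q * (P * A) := by
    rw [← mul_assoc, h.Q_mul_P, ← sub_eq_zero, ← neg_eq_zero, neg_sub, ← sub_mul, ← h.F_mul_F,
      mul_assoc, hA, mul_zero]
  exact LinearMap.ext fun X ↦ h.injective_Q (DFunLike.congr_fun hQA X)

lemma eq_of_F_mul_eq {A B : Module.End 𝕜 V} (hF : F * A = F * B) (hP : P * A = P * B) :
    A = B := by
  have := h.eq_P_mul_of_F_mul_eq_zero (A := A - B) (by rw [mul_sub, hF, sub_self])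
  rwa [mul_sub, hP, sub_self, sub_eq_zero] at this

/-! ### Curvature invariance of the contact distribution -/

theorem P_curv_eq_zero [CharZero 𝕜]
    (hQ : ∀ X Y Z, P X = 0 → P Y = 0 → P Z = 0 → P (L.curv (Q X - X) Y Z) = 0) {X Y Z : V}
    (hX : P X = 0) (hY : P Y = 0) (hZ : P Z = 0) : P (L.curv X Y Z) = 0 := by
  refine (h.P_eq_zero_iff _).2 fun i ↦ ?_
  have sq₁ : ∀ X Y Z : {X // P X = 0},
      L.met (L.curv (F (F X)) Y Z) (ξ i) = -L.met (L.curv X Y Z) (ξ i) := by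
    rintro ⟨X, hX⟩ ⟨Y, hY⟩ ⟨Z, hZ⟩
    have hFF : F (F X) = -(Q X - X) - X := by
      have := DFunLike.congr_fun h.F_mul_F X
      rw [Module.End.mul_apply, LinearMap.sub_apply, hX] at this
      rw [this]; abel
    rw [hFF, curv_sub_left, curv_neg_left]
    simp [(h.P_eq_zero_iff _).1 (hQ X Y Z hX hY hZ) i]
  have sq₂ : ∀ X Y Z : {X // P X = 0},
      L.met (L.curv X (F (F Y)) Z) (ξ i) = -L.met (L.curv X Y Z) (ξ i) := fun X Y Z ↦ by
    rw [L.met_curv_swap, sq₁ Y X Z, L.met_curv_swap X]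
  have sq₃ : ∀ X Y Z : {X // P X = 0},
      L.met (L.curv X Y (F (F Z))) (ξ i) = -L.met (L.curv X Y Z) (ξ i) := fun X Y Z ↦ by
    have hFFZ := L.met_bianchi X Y (F (F Z)) (ξ i)
    rw [sq₂ Y Z X, sq₁ Z X Y] at hFFZ
    linear_combination (norm := module) hFFZ + L.met_bianchi X Y Z (ξ i)
  have hder : ∀ X Y Z : {X // P X = 0}, L.met (L.curv (F X) Y Z) (ξ i)
      + L.met (L.curv X (F Y) Z) (ξ i) + L.met (L.curv X Y (F Z)) (ξ i) = 0 := fun X Y Z ↦ by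
    have := derivCurv_eq_zero h.isSkewAdjoint_F h.nearly X Y Z (ξ i)
    rwa [derivCurv, h.F_ξ, map_zero, add_zero] at this
  exact eq_zero_of_derivation_of_sq (𝕜 := 𝕜)
    (T := fun X Y Z : {X // P X = 0} ↦ L.met (L.curv X Y Z) (ξ i))
    (J := fun X ↦ ⟨F X, h.P_F_apply X⟩) hder sq₁ sq₂ sq₃ ⟨X, hX⟩ ⟨Y, hY⟩ ⟨Z, hZ⟩

theorem met_curv_ξ_F_F_eq_zero [CharZero 𝕜]
    (hR : ∀ X Y Z, P X = 0 → P Y = 0 → P Z = 0 → P (L.curv X Y Z) = 0) (i : ι) (X Y : V) {Z : V}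
    (hZ : P Z = 0) : L.met (L.curv (ξ i) Z (F X)) (F Y) = 0 := by
  rw [L.met_curv_pair_symm, L.met_curv_skew,
    (h.P_eq_zero_iff _).1 (hR _ _ _ (h.P_F_apply X) (h.P_F_apply Y) hZ), neg_zero]

theorem met_curv_ξ_F_F_eq_zero_of_curv_ξ_ξ [CharZero 𝕜]
    (hR : ∀ X Y Z, P X = 0 → P Y = 0 → P Z = 0 → P (L.curv X Y Z) = 0)
    (hξ : ∀ i j, L.curv (ξ i) (ξ j) = 0) (i : ι) (X Y Z : V) :
    L.met (L.curv (ξ i) Z (F X)) (F Y) = 0 := by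
  have hP : P (L.curv (F X) (F Y) (ξ i)) = 0 := (h.P_eq_zero_iff _).2 fun j ↦ by
    rw [L.met_curv_pair_symm, hξ, LinearMap.zero_apply, map_zero, LinearMap.zero_apply]
  have hPZ : P (Z - P Z) = 0 := by
    rw [map_sub, ← Module.End.mul_apply, h.P_mul_P, sub_self]
  rw [L.met_curv_pair_symm, ← sub_add_cancel Z (P Z), map_add, ← h.isSelfAdjoint_P, hP, map_zero,
    LinearMap.zero_apply, add_zero, ← L.met_curv_pair_symm, h.met_curv_ξ_F_F_eq_zero hR i X Y hPZ]

/-! ### Parallel `Q` and commuting characteristic fields -/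

include h in
lemma commute_con_Q (hQ : ∀ X Y, P Y = 0 → (⁅L.con X, Q⁆ : Module.End 𝕜 V) Y = 0) (X : V) :
    Commute (L.con X) Q := by
  have hP : ⁅L.con X, Q⁆ * (1 - P) = 0 := LinearMap.ext fun Y ↦ hQ X _ <| by
    rw [← Module.End.mul_apply, mul_sub, mul_one, h.P_mul_P, sub_self, LinearMap.zero_apply]
  have hP' : (1 - P) * ⁅L.con X, Q⁆ = 0 := by
    refine mul_eq_zero_of_isAdjointPair (isSelfAdjoint_con_lie h.isSelfAdjoint_Q X) ?_ hP
    exact LinearMap.IsAdjointPair.sub (LinearMap.isAdjointPair_one) h.isSelfAdjoint_P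
  have hPP : P * ⁅L.con X, Q⁆ * P = 0 := by
    rw [Ring.lie_def, mul_sub, sub_mul, mul_assoc, mul_assoc (L.con X), h.Q_mul_P, ← mul_assoc P Q,
      h.P_mul_Q, mul_assoc, sub_self]
  rw [mul_sub, mul_one, sub_eq_zero] at hP
  rw [sub_mul, one_mul, sub_eq_zero] at hP'
  rw [commute_iff_lie_eq, hP, hP', hPP]

variable (L ξ) in
/-- The endomorphism `X ↦ ∇_X (ξ i)`. -/
def shape (i : ι) : Module.End 𝕜 V :=
  LinearMap.flip (R₂ := 𝕜) (M := V) (N := V) (P := V) L.con (ξ i)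

variable (L F ξ) in
/-- The endomorphism `X ↦ f² ∇_X (ξ i)`. When `Q` is parallel, it is the opposite of the component
of `shape` in the contact distribution. -/
def contactShape (i : ι) : Module.End 𝕜 V := F * F * shape L ξ i

variable (L ξ) in
/-- The endomorphism `X ↦ R_{ξ i, X} (ξ j)`, written out for commuting fields `ξ i`. -/
def jacobiEnd (i j : ι) : Module.End 𝕜 V :=
  ⁅L.con (ξ i), shape L ξ j⁆ + shape L ξ j * shape L ξ i

section

include h

lemma lie_con_ξ_F (i : ι) : ⁅L.con (ξ i), F⁆ = F * shape L ξ i := by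
  refine LinearMap.ext fun X ↦ ?_
  rw [h.nearly, Ring.lie_def, LinearMap.sub_apply, Module.End.mul_apply, h.F_ξ, map_zero, zero_sub,
    neg_neg]
  rfl

lemma contactShape_eq (i : ι) : contactShape L F ξ i = F * ⁅L.con (ξ i), F⁆ := by
  rw [h.lie_con_ξ_F, ← mul_assoc]; rfl

lemma P_mul_lie_con_ξ_F (i : ι) : P * ⁅L.con (ξ i), F⁆ = 0 := by
  rw [h.lie_con_ξ_F, ← mul_assoc, h.P_mul_F, zero_mul]

lemma lie_con_ξ_F_mul_P (i : ι) : ⁅L.con (ξ i), F⁆ * P = 0 := by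
  have := mul_eq_zero_of_isAdjointPair (B' := -⁅L.con (ξ i), F⁆) h.isSelfAdjoint_P
    (isSkewAdjoint_con_lie h.isSkewAdjoint_F (ξ i)) (h.P_mul_lie_con_ξ_F i)
  rwa [neg_mul, neg_eq_zero] at this

lemma P_mul_contactShape (i : ι) : P * contactShape L F ξ i = 0 := by
  rw [h.contactShape_eq, ← mul_assoc, h.P_mul_F, zero_mul]

lemma contactShape_mul_P (i : ι) : contactShape L F ξ i * P = 0 := by
  rw [h.contactShape_eq, mul_assoc, h.lie_con_ξ_F_mul_P, mul_zero]

lemma commute_con_ξ_P (i : ι) : Commute (L.con (ξ i)) P := by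
  have hFNP : F * (L.con (ξ i) * P) = 0 := by
    have := h.lie_con_ξ_F_mul_P i
    rwa [Ring.lie_def, sub_mul, mul_assoc, h.F_mul_P, mul_zero, zero_sub, neg_eq_zero,
      mul_assoc] at this
  have hDP : ⁅L.con (ξ i), P⁆ * P = 0 := by
    rw [Ring.lie_def, sub_mul, mul_assoc, h.P_mul_P, mul_assoc, ← h.eq_P_mul_of_F_mul_eq_zero hFNP,
      sub_self]
  have hPD : P * ⁅L.con (ξ i), P⁆ = 0 := mul_eq_zero_of_isAdjointPair
    (isSelfAdjoint_con_lie h.isSelfAdjoint_P (ξ i)) h.isSelfAdjoint_P hDP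
  have leibniz : ⁅L.con (ξ i), P * P⁆ = ⁅L.con (ξ i), P⁆ * P + P * ⁅L.con (ξ i), P⁆ := by
    simp only [Ring.lie_def]
    noncomm_ring
  rw [commute_iff_lie_eq, ← h.P_mul_P, leibniz, hDP, hPD, add_zero]

variable (hQ : ∀ X, Commute (L.con X) Q)

include hQ in
lemma commute_con_ξ_F_mul_F (i : ι) : Commute (L.con (ξ i)) (F * F) := by
  rw [h.F_mul_F]; exact (h.commute_con_ξ_P i).sub_right (hQ _)

include hQ in
lemma lie_con_ξ_F_mul_F (i : ι) : ⁅L.con (ξ i), F⁆ * F = -(F * ⁅L.con (ξ i), F⁆) := by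
  have hFF := (h.commute_con_ξ_F_mul_F hQ i).eq
  rw [← sub_eq_zero] at hFF ⊢
  rw [← hFF, Ring.lie_def]
  noncomm_ring

include hQ in
lemma Q_mul_shape (i : ι) : Q * shape L ξ i = shape L ξ i := LinearMap.ext fun X ↦ by
  have := DFunLike.congr_fun (hQ X).eq (ξ i)
  rw [Module.End.mul_apply, Module.End.mul_apply, h.Q_ξ] at this
  exact this.symm

include hQ in
lemma shape_eq (i : ι) : shape L ξ i = P * shape L ξ i - contactShape L F ξ i := by
  rw [contactShape, h.F_mul_F, sub_mul, h.Q_mul_shape hQ, sub_sub_cancel]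

include hQ in
lemma F_mul_contactShape (i : ι) : F * contactShape L F ξ i = -⁅L.con (ξ i), F⁆ := by
  have hFP : F * (P * shape L ξ i) = 0 := by rw [← mul_assoc, h.F_mul_P, zero_mul]
  rw [h.lie_con_ξ_F, h.shape_eq hQ, mul_sub, hFP, zero_sub, neg_neg]

include hQ in
lemma contactShape_mul_F (i : ι) : contactShape L F ξ i * F = ⁅L.con (ξ i), F⁆ := by
  rw [h.contactShape_eq, mul_assoc, h.lie_con_ξ_F_mul_F hQ, mul_neg, ← h.contactShape_eq,
    h.F_mul_contactShape hQ, neg_neg]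

include hQ in
lemma isSkewAdjoint_contactShape (i : ι) : L.met.IsSkewAdjoint (contactShape L F ξ i) := by
  have hF : LinearMap.IsAdjointPair L.met L.met F (-F : Module.End 𝕜 V) := h.isSkewAdjoint_F
  have hS : LinearMap.IsAdjointPair L.met L.met (⁅L.con (ξ i), F⁆ : Module.End 𝕜 V)
      (-⁅L.con (ξ i), F⁆ : Module.End 𝕜 V) :=
    isSkewAdjoint_con_lie h.isSkewAdjoint_F (ξ i)
  have hFS := hF.mul hS
  rwa [neg_mul_neg, h.lie_con_ξ_F_mul_F hQ, ← h.contactShape_eq] at hFS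

include hQ in
lemma commute_contactShape_mul_contactShape_F (i j : ι) :
    Commute (contactShape L F ξ i * contactShape L F ξ j) F := by
  rw [Commute, SemiconjBy, mul_assoc, h.contactShape_mul_F hQ, ← mul_assoc,
    h.F_mul_contactShape hQ i, ← h.contactShape_mul_F hQ i, neg_mul, mul_assoc,
    h.F_mul_contactShape hQ, mul_neg, neg_neg]

include hQ in
lemma jacobiEnd_eq (i j : ι) :
    jacobiEnd L ξ i j = P * jacobiEnd L ξ i j - ⁅L.con (ξ i), contactShape L F ξ j⁆
      + contactShape L F ξ j * contactShape L F ξ i := by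
  have hc : contactShape L F ξ j * shape L ξ i
      = -(contactShape L F ξ j * contactShape L F ξ i) := by
    rw [h.shape_eq hQ i, mul_sub, ← mul_assoc, h.contactShape_mul_P, zero_mul, zero_sub]
  have hlie : ⁅L.con (ξ i), shape L ξ j⁆
      = P * ⁅L.con (ξ i), shape L ξ j⁆ - ⁅L.con (ξ i), contactShape L F ξ j⁆ := by
    have hNP := (h.commute_con_ξ_P i).eq
    conv_lhs => rw [h.shape_eq hQ j, Ring.lie_def, mul_sub, ← mul_assoc, hNP]
    simp only [Ring.lie_def]
    noncomm_ring
  have hmul : shape L ξ j * shape L ξ i = P * (shape L ξ j * shape L ξ i)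
      + contactShape L F ξ j * contactShape L F ξ i := by
    conv_lhs => rw [h.shape_eq hQ j, sub_mul, hc, sub_neg_eq_add, mul_assoc]
  conv_lhs => rw [jacobiEnd, hlie, hmul]
  rw [jacobiEnd, mul_add]
  abel

end

section Commuting

variable [CharZero 𝕜] (hcomm : ∀ i j, L.con (ξ i) (ξ j) = L.con (ξ j) (ξ i))

include h hcomm

lemma con_ξ_ξ (i j : ι) : L.con (ξ i) (ξ j) = 0 := by
  have hF : F (L.con (ξ i) (ξ j)) = 0 := by
    have := h.nearly (ξ i) (ξ j)
    simp only [Ring.lie_def, LinearMap.sub_apply, Module.End.mul_apply, h.F_ξ, map_zero, zero_sub,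
      hcomm j i] at this
    linear_combination (norm := module) (-1 / 2 : 𝕜) • this
  have hskew : ∀ i j k, L.met (L.con (ξ i) (ξ j)) (ξ k) = -L.met (L.con (ξ i) (ξ k)) (ξ j) :=
    fun i j k ↦ by
      have := L.der_met (ξ i) (ξ j) (ξ k)
      rw [h.der_met_ξ, L.met_symm (ξ j)] at this
      exact eq_neg_of_add_eq_zero_left this.symm
  have hP : P (L.con (ξ i) (ξ j)) = 0 := (h.P_eq_zero_iff _).2 fun k ↦ by
    have := hskew i j k
    rw [hcomm i k, hskew k i j, hcomm k j, hskew j k i, hcomm j i] at this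
    linear_combination (norm := module) (1 / 2 : 𝕜) • this
  have hQ0 : Q (L.con (ξ i) (ξ j)) = 0 := by
    rw [eq_sub_of_add_eq' h.P_eq.symm, LinearMap.sub_apply, Module.End.mul_apply, hF, hP,
      map_zero, sub_zero]
  exact h.injective_Q (hQ0.trans (map_zero Q).symm)

lemma curv_ξ_ξ_eq_lie (i j : ι) : L.curv (ξ i) (ξ j) = ⁅L.con (ξ i), L.con (ξ j)⁆ := by
  rw [curv, h.con_ξ_ξ hcomm, h.con_ξ_ξ hcomm, sub_zero, map_zero, sub_zero]

lemma P_mul_curv_ξ_ξ (i j : ι) : P * L.curv (ξ i) (ξ j) = 0 := by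
  refine LinearMap.ext fun X ↦ (h.P_eq_zero_iff _).2 fun k ↦ ?_
  rw [L.met_curv_skew, h.curv_ξ_ξ_eq_lie hcomm, Ring.lie_def, LinearMap.sub_apply,
    Module.End.mul_apply, Module.End.mul_apply]
  simp only [h.con_ξ_ξ hcomm, map_zero, sub_zero, LinearMap.zero_apply, neg_zero]

lemma jacobiEnd_apply (i j : ι) (X : V) : jacobiEnd L ξ i j X = L.curv (ξ i) X (ξ j) := by
  simp only [jacobiEnd, shape, curv_apply, h.con_ξ_ξ hcomm, Ring.lie_def, LinearMap.sub_apply,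
    LinearMap.add_apply, Module.End.mul_apply, LinearMap.flip_apply, map_sub, map_zero]
  abel

lemma curv_ξ_ξ_eq_jacobiEnd_sub (i j : ι) :
    L.curv (ξ i) (ξ j) = jacobiEnd L ξ i j - jacobiEnd L ξ j i := LinearMap.ext fun X ↦ by
  have bianchi := L.bianchi (ξ i) (ξ j) X
  rw [L.curv_swap X, LinearMap.neg_apply] at bianchi
  rw [LinearMap.sub_apply, h.jacobiEnd_apply hcomm, h.jacobiEnd_apply hcomm]
  linear_combination (norm := module) bianchi

lemma commute_jacobiEnd_F (i j : ι) : Commute (jacobiEnd L ξ i j) F := by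
  refine LinearMap.ext fun X ↦ ext_met (L := L) fun Z ↦ ?_
  have := derivCurv_eq_zero h.isSkewAdjoint_F h.nearly (ξ i) X (ξ j) Z
  simp only [derivCurv, h.F_ξ, curv_zero_left, LinearMap.zero_apply, map_zero, zero_add,
    add_zero] at this
  rw [Module.End.mul_apply, Module.End.mul_apply, met_apply_of_isSkewAdjoint h.isSkewAdjoint_F,
    h.jacobiEnd_apply hcomm, h.jacobiEnd_apply hcomm]
  exact eq_neg_of_add_eq_zero_left this

lemma commute_lie_con_ξ_contactShape_F (hQ : ∀ X, Commute (L.con X) Q) (i j : ι) :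
    Commute ⁅L.con (ξ i), contactShape L F ξ j⁆ F := by
  have heq : ⁅L.con (ξ i), contactShape L F ξ j⁆ = P * jacobiEnd L ξ i j
      + contactShape L F ξ j * contactShape L F ξ i - jacobiEnd L ξ i j := by
    rw [eq_sub_iff_add_eq]
    nth_rewrite 1 [h.jacobiEnd_eq hQ]
    abel
  have hPJ : Commute (P * jacobiEnd L ξ i j) F := by
    rw [Commute, SemiconjBy, mul_assoc, (h.commute_jacobiEnd_F hcomm i j).eq, ← mul_assoc,
      h.P_mul_F, ← mul_assoc, h.F_mul_P, zero_mul]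
  rw [heq]
  exact (hPJ.add_left (h.commute_contactShape_mul_contactShape_F hQ j i)).sub_left
    (h.commute_jacobiEnd_F hcomm i j)

lemma lie_con_ξ_contactShape (hQ : ∀ X, Commute (L.con X) Q) (i j : ι) :
    ⁅L.con (ξ i), contactShape L F ξ j⁆
      = (1 / 2 : 𝕜) • ⁅contactShape L F ξ i, contactShape L F ξ j⁆ := by
  have anticomm : contactShape L F ξ j * F + F * contactShape L F ξ j = 0 := by
    rw [h.contactShape_mul_F hQ, h.F_mul_contactShape hQ, add_neg_cancel]
  have hderiv : ⁅L.con (ξ i), contactShape L F ξ j⁆ * F + contactShape L F ξ j * ⁅L.con (ξ i), F⁆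
      + ⁅L.con (ξ i), F⁆ * contactShape L F ξ j
      + F * ⁅L.con (ξ i), contactShape L F ξ j⁆ = 0 := by
    have : ⁅L.con (ξ i), contactShape L F ξ j * F + F * contactShape L F ξ j⁆ = 0 := by
      rw [anticomm, Ring.lie_def, mul_zero, zero_mul, sub_zero]
    rw [← this]
    simp only [Ring.lie_def]
    noncomm_ring
  refine h.eq_of_F_mul_eq ?_ ?_
  · have hcF : contactShape L F ξ j * ⁅L.con (ξ i), F⁆
        = F * (contactShape L F ξ j * contactShape L F ξ i) := by
      rw [← h.contactShape_mul_F hQ i, ← mul_assoc,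
        (h.commute_contactShape_mul_contactShape_F hQ j i).eq]
    have hFc : ⁅L.con (ξ i), F⁆ * contactShape L F ξ j
        = -(F * (contactShape L F ξ i * contactShape L F ξ j)) := by
      rw [← mul_assoc, h.F_mul_contactShape hQ i, neg_mul, neg_neg]
    rw [(h.commute_lie_con_ξ_contactShape_F hcomm hQ i j).eq, hcF, hFc] at hderiv
    rw [mul_smul_comm, Ring.lie_def (contactShape L F ξ i), mul_sub]
    linear_combination (norm := module) (1 / 2 : 𝕜) • hderiv
  · rw [mul_smul_comm, Ring.lie_def, Ring.lie_def, mul_sub, mul_sub, ← mul_assoc P, ← mul_assoc P,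
      ← mul_assoc P, ← mul_assoc P, ← (h.commute_con_ξ_P i).eq, mul_assoc _ P,
      h.P_mul_contactShape, h.P_mul_contactShape]
    simp only [mul_zero, zero_mul, sub_zero, smul_zero]

lemma curv_ξ_ξ_eq (hQ : ∀ X, Commute (L.con X) Q) (i j : ι) : L.curv (ξ i) (ξ j)
    = (-2 : 𝕜) • ⁅contactShape L F ξ i, contactShape L F ξ j⁆ := by
  have hP : P * jacobiEnd L ξ i j = P * jacobiEnd L ξ j i := by
    rw [← sub_eq_zero, ← mul_sub, ← h.curv_ξ_ξ_eq_jacobiEnd_sub hcomm, h.P_mul_curv_ξ_ξ hcomm]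
  rw [h.curv_ξ_ξ_eq_jacobiEnd_sub hcomm, h.jacobiEnd_eq hQ i j, h.jacobiEnd_eq hQ j i, hP,
    h.lie_con_ξ_contactShape hcomm hQ, h.lie_con_ξ_contactShape hcomm hQ]
  simp only [Ring.lie_def]
  module

lemma lie_lie_contactShape (hQ : ∀ X, Commute (L.con X) Q) (i j k : ι) :
    ⁅⁅contactShape L F ξ i, contactShape L F ξ j⁆, contactShape L F ξ k⁆ = 0 := by
  have hN : ∀ i j, ⁅L.con (ξ i), L.con (ξ j)⁆
      = (-2 : 𝕜) • ⁅contactShape L F ξ i, contactShape L F ξ j⁆ := fun i j ↦ by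
    rw [← h.curv_ξ_ξ_eq_lie hcomm, h.curv_ξ_ξ_eq hcomm hQ]
  let _ := LieRing.ofAssociativeRing (A := Module.End 𝕜 V)
  exact lie_lie_lie_eq_zero (𝕜 := 𝕜) (𝔤 := Module.End 𝕜 V)
    (h.lie_con_ξ_contactShape hcomm hQ) hN i j k

end Commuting

end WeakNearlyCModel

/-! ### Smoothness of the Levi-Civita connection -/

section Smoothness

variable {E : Type*} [NormedAddCommGroup E] [NormedSpace ℝ E]
  {H : Type*} [TopologicalSpace H] {I : ModelWithCorners ℝ E H}
  {M : Type*} [TopologicalSpace M] [ChartedSpace H M]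

lemma contMDiffAt_matrixDet {ι : Type*} [Fintype ι] [DecidableEq ι] {k : ℕ∞ω}
    {A : M → Matrix ι ι ℝ} {x : M} (hA : ∀ i j, CMDiffAt k (fun y ↦ A y i j) x) :
    CMDiffAt k (fun y ↦ (A y).det) x := by
  simp only [Matrix.det_apply']
  exact contMDiffAt_finsetSum fun σ _ ↦ contMDiffAt_const.mul
    (contMDiffAt_finsetProd fun i _ ↦ hA _ _)

lemma exists_contMDiffSection_eq [FiniteDimensional ℝ E] [IsManifold I ∞ M] [T2Space M]
    {F : Type*} [NormedAddCommGroup F] [NormedSpace ℝ F] {V : M → Type*}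
    [TopologicalSpace (TotalSpace F V)] [∀ x, AddCommGroup (V x)] [∀ x, Module ℝ (V x)]
    [∀ x, TopologicalSpace (V x)] [FiberBundle F V] [VectorBundle ℝ F V]
    [ContMDiffVectorBundle ∞ F V I] {x : M} (v : V x) : ∃ σ : Cₛ^∞⟮I; F, V⟯, σ x = v := by
  obtain ⟨s, hs, hsmooth⟩ := FiberBundle.exists_contMDiffOn_extend (k := ∞) I F v
  obtain ⟨u, hus, hu, hxu⟩ := mem_nhds_iff.1 hs
  obtain ⟨b, -, hb⟩ := (SmoothBumpFunction.nhds_basis_tsupport (I := I) x).mem_iff.1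
    (hu.mem_nhds hxu)
  refine ⟨⟨_, ContMDiffOn.smul_section_of_tsupport b.contMDiff.contMDiffOn hu hb
    (hsmooth.mono hus)⟩, ?_⟩
  simp [ContMDiffSection.coeFn_mk]

variable [IsManifold I ∞ M]

lemma contMDiffAt_mvfderiv_apply {c : M → ℝ} {X : Π x : M, TangentSpace I x} {x : M}
    (hc : CMDiffAt ∞ c x) (hX : CMDiffAt ∞ (T% X) x) :
    CMDiffAt ∞ (fun y ↦ d% c y (X y)) x := by
  have := IsManifold.of_le (I := I) (M := M) (m := 1) (n := ∞) (by simp)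
  have h := ContMDiffAt.clm_apply_of_inCoordinates (b₁ := id) (b₂ := c) (v := X)
    (ϕ := fun y ↦ mfderiv% c y) (hc.mfderiv_const (m := ∞) (by simp)) hX hc
  rw [contMDiffAt_totalSpace] at h
  simpa using! h.2

lemma contMDiffAt_mlieBracket [FiniteDimensional ℝ E] {X Y : Π x : M, TangentSpace I x} {x : M}
    (hX : CMDiffAt ∞ (T% X) x) (hY : CMDiffAt ∞ (T% Y) x) :
    CMDiffAt ∞ (T% (mlieBracket I X Y)) x := by
  have := IsManifold.of_le (I := I) (M := M) (m := minSmoothness ℝ 2) (n := ∞)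
    (by simpa using ENat.LEInfty.out)
  have : IsManifold I (((⊤ : ℕ∞) : ℕ∞ω) + 1) M := by simpa
  have := FiniteDimensional.complete ℝ E
  exact ContMDiffAt.mlieBracket_vectorField (m := ⊤) (n := ⊤) hX hY (by simp)

variable (g : ContMDiffRiemannianMetric I ∞ E (fun x : M ↦ TangentSpace I x))

lemma contMDiffAt_metric {X Y : Π x : M, TangentSpace I x} {x : M}
    (hX : CMDiffAt ∞ (T% X) x) (hY : CMDiffAt ∞ (T% Y) x) :
    CMDiffAt ∞ (fun y ↦ g.inner y (X y) (Y y)) x := by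
  let _ : RiemannianBundle (fun x : M ↦ TangentSpace I x) := ⟨g.toRiemannianMetric⟩
  exact ContMDiffAt.inner_bundle (F := E) (E := fun x : M ↦ TangentSpace I x) (b := id) hX hY

lemma contMDiffAt_koszul [FiniteDimensional ℝ E] {X Y Z : Π x : M, TangentSpace I x} {x : M}
    (hX : CMDiffAt ∞ (T% X) x) (hY : CMDiffAt ∞ (T% Y) x) (hZ : CMDiffAt ∞ (T% Z) x) :
    CMDiffAt ∞ (koszul g X Y Z) x := by
  have hder : ∀ {U V W : Π x : M, TangentSpace I x}, CMDiffAt ∞ (T% U) x → CMDiffAt ∞ (T% V) x →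
      CMDiffAt ∞ (T% W) x → CMDiffAt ∞ (fun y ↦ d% (fun z ↦ g.inner z (U z) (V z)) y (W y)) x :=
    fun hU hV hW ↦ contMDiffAt_mvfderiv_apply (contMDiffAt_metric g hU hV) hW
  have hbracket : ∀ {U V W : Π x : M, TangentSpace I x}, CMDiffAt ∞ (T% U) x →
      CMDiffAt ∞ (T% V) x → CMDiffAt ∞ (T% W) x →
      CMDiffAt ∞ (fun y ↦ g.inner y (mlieBracket I U V y) (W y)) x :=
    fun hU hV hW ↦ contMDiffAt_metric g (contMDiffAt_mlieBracket hU hV) hW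
  exact ((((((hder hY hZ hX).add (hder hX hZ hY)).sub (hder hX hY hZ)).add
    (hbracket hX hY hZ)).sub (hbracket hX hZ hY)).sub (hbracket hY hZ hX)).div_const 2

/-- The Gram matrix of a family of vector fields. -/
def gram {ι : Type*} (Z : ι → Π x : M, TangentSpace I x) (x : M) : Matrix ι ι ℝ :=
  .of fun i j ↦ g.inner x (Z i x) (Z j x)

variable {ι : Type*} [Fintype ι] [DecidableEq ι]

lemma det_gram_ne_zero {Z : ι → Π x : M, TangentSpace I x} {x : M}
    (hZ : LinearIndependent ℝ fun i ↦ Z i x) : (gram g Z x).det ≠ 0 := by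
  let _ : RiemannianBundle (fun x : M ↦ TangentSpace I x) := ⟨g.toRiemannianMetric⟩
  exact Matrix.det_gram_ne_zero_iff_linearIndependent.2 hZ

lemma det_gram_mul_coeff (Z : ι → Π x : M, TangentSpace I x) (x : M) (c : ι → ℝ) (i : ι) :
    (gram g Z x).det * c i = ((gram g Z x).updateCol i
      fun k ↦ g.inner x (∑ j, c j • Z j x) (Z k x)).det := by
  have hc : (fun k ↦ g.inner x (∑ j, c j • Z j x) (Z k x)) = (gram g Z x).mulVec c := by
    ext k
    simp [gram, Matrix.mulVec, dotProduct, g.symm x (Z k x), mul_comm]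
  rw [hc, ← Matrix.cramer_apply, Matrix.cramer_eq_adjugate_mulVec, Matrix.mulVec_mulVec,
    Matrix.adjugate_mul, Matrix.smul_mulVec, Matrix.one_mulVec, Pi.smul_apply, smul_eq_mul]

lemma contMDiffAt_of_metric_frame [FiniteDimensional ℝ E] {ι : Type*} [Finite ι]
    {Z : ι → Π x : M, TangentSpace I x} {u : Set M} (hZ : IsLocalFrameOn I E ∞ Z u)
    (hu : IsOpen u) {W : Π x : M, TangentSpace I x} {x : M} (hx : x ∈ u)
    (hW : ∀ i, CMDiffAt ∞ (fun y ↦ g.inner y (W y) (Z i y)) x) :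
    CMDiffAt ∞ (T% W) x := by
  classical
  have := Fintype.ofFinite ι
  have hdet : ∀ y ∈ u, (gram g Z y).det ≠ 0 := fun y hy ↦
    det_gram_ne_zero g (hZ.linearIndependent hy)
  have hgram : ∀ k l, CMDiffAt ∞ (fun y ↦ gram g Z y k l) x := fun k l ↦
    contMDiffAt_metric g (hZ.contMDiffAt hu hx k) (hZ.contMDiffAt hu hx l)
  refine hZ.contMDiffAt_of_coeff (fun i ↦ ?_) (hu.mem_nhds hx)
  have hcramer : CMDiffAt ∞ (fun y ↦ (gram g Z y).det⁻¹ *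
      ((gram g Z y).updateCol i fun k ↦ g.inner y (W y) (Z k y)).det) x := by
    refine ((contMDiffAt_matrixDet hgram).inv₀ (hdet x hx)).mul
      (contMDiffAt_matrixDet fun k l ↦ ?_)
    by_cases hl : l = i
    · subst hl; simpa using hW k
    · simpa [Matrix.updateCol_ne hl] using hgram k l
  refine hcramer.congr_of_eventuallyEq ?_
  filter_upwards [hu.mem_nhds hx] with y hy
  have h := det_gram_mul_coeff g Z y (fun j ↦ hZ.coeff j y (W y)) i
  rw [← hZ.coeff_sum_eq W hy] at h
  exact (eq_inv_mul_iff_mul_eq₀ (hdet y hy)).2 h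

end Smoothness

/-! ### Smooth vector fields as an algebraic model -/

section SmoothField

variable {E : Type*} [NormedAddCommGroup E] [NormedSpace ℝ E]
  {H : Type*} [TopologicalSpace H] {I : ModelWithCorners ℝ E H}
  {M : Type*} [TopologicalSpace M] [ChartedSpace H M] [IsManifold I ∞ M]
  {X Y Z : Π x : M, TangentSpace I x} {c : M → ℝ}

lemma SmoothField.mdiffAt (hX : SmoothField X) (x : M) : MDiffAt (T% X) x :=
  (hX x).mdifferentiableAt (by simp)

lemma SmoothField.app {T : EndField I M} (hT : SmoothEndField T) (hX : SmoothField X) :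
    SmoothField (T.app X) :=
  fun x ↦ ContMDiffAt.clm_bundle_apply (F₁ := E) (F₂ := E) (hT x) (hX x)

lemma SmoothField.smul (hc : CMDiff ∞ c) (hX : SmoothField X) : SmoothField (c • X) :=
  ContMDiff.smul_section hc hX

lemma SmoothField.contMDiff_mvfderiv (hX : SmoothField X) (hc : CMDiff ∞ c) :
    CMDiff ∞ (fun x ↦ d% c x (X x)) :=
  fun x ↦ contMDiffAt_mvfderiv_apply (hc x) (hX x)

variable [FiniteDimensional ℝ E]

lemma SmoothField.mlieBracket (hX : SmoothField X) (hY : SmoothField Y) :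
    SmoothField (mlieBracket I X Y) :=
  fun x ↦ contMDiffAt_mlieBracket (hX x) (hY x)

lemma SmoothField.nabla (g : ContMDiffRiemannianMetric I ∞ E (fun x : M ↦ TangentSpace I x))
    (hX : SmoothField X) (hY : SmoothField Y) : SmoothField (nabla g X Y) := fun x ↦ by
  let e := trivializationAt E (TangentSpace I : M → Type _) x
  have hZ := e.isLocalFrameOn_localFrame_baseSet I ∞ (Module.finBasis ℝ E)
  have hx : x ∈ e.baseSet := FiberBundle.mem_baseSet_trivializationAt' x
  refine contMDiffAt_of_metric_frame g hZ e.open_baseSet hx fun i ↦ ?_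
  refine (contMDiffAt_koszul g (hX x) (hY x)
    (hZ.contMDiffAt e.open_baseSet hx i)).congr_of_eventuallyEq ?_
  filter_upwards [e.open_baseSet.mem_nhds hx] with y hy
  exact metric_nablaAt g (hX.mdiffAt y) (hY.mdiffAt y)
    ((hZ.contMDiffAt e.open_baseSet hy i).mdifferentiableAt (by simp))

lemma jacobi_mlieBracket (hX : SmoothField X) (hY : SmoothField Y) (hZ : SmoothField Z) :
    mlieBracket I X (mlieBracket I Y Z)
      = mlieBracket I (mlieBracket I X Y) Z + mlieBracket I Y (mlieBracket I X Z) := by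
  have := IsManifold.of_le (I := I) (M := M) (m := minSmoothness ℝ 3) (n := ∞)
    (by simpa using ENat.LEInfty.out)
  have := FiniteDimensional.complete ℝ E
  have h2 : minSmoothness ℝ 2 ≤ ∞ := by simpa using ENat.LEInfty.out
  exact leibniz_identity_mlieBracket (ContMDiff.of_le hX h2) (ContMDiff.of_le hY h2)
    (ContMDiff.of_le hZ h2)

lemma mlieBracket_smul (hc : CMDiff ∞ c) (hY : SmoothField Y) :
    mlieBracket I X (c • Y) = (fun x ↦ d% c x (X x)) • Y + c • mlieBracket I X Y := by
  ext x
  exact mlieBracket_smul_right ((hc x).mdifferentiableAt (by simp)) (hY.mdiffAt x)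

lemma mlieBracket_mlieBracket_smul (hc : CMDiff ∞ c) (hY : SmoothField Y) (hZ : SmoothField Z)
    (x : M) :
    mlieBracket I X (mlieBracket I Y (c • Z)) x
      = d% (fun y ↦ d% c y (Y y)) x (X x) • Z x + d% c x (Y x) • mlieBracket I X Z x
        + (d% c x (X x) • mlieBracket I Y Z x + c x • mlieBracket I X (mlieBracket I Y Z) x) := by
  have hYc := hY.contMDiff_mvfderiv hc
  rw [mlieBracket_smul hc hZ, mlieBracket_add_right ((hZ.smul hYc).mdiffAt x)
    (((hY.mlieBracket hZ).smul hc).mdiffAt x), mlieBracket_smul hYc hZ,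
    mlieBracket_smul hc (hY.mlieBracket hZ)]
  rfl

-- Comparing the Jacobi identities for `X, Y, Z` and for `X, Y, c • Z` isolates the coefficient of
-- `Z x`, which can be chosen nonzero.
lemma mvfderiv_mlieBracket [T2Space M] (hc : CMDiff ∞ c) (hX : SmoothField X) (hY : SmoothField Y)
    (x : M) : d% c x (mlieBracket I X Y x)
      = d% (fun y ↦ d% c y (Y y)) x (X x) - d% (fun y ↦ d% c y (X y)) x (Y x) := by
  rcases subsingleton_or_nontrivial (TangentSpace I x) with _ | _
  · simp only [Subsingleton.elim _ (0 : TangentSpace I x), map_zero, sub_zero]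
  obtain ⟨v, hv⟩ := exists_ne (0 : TangentSpace I x)
  obtain ⟨Z, rfl⟩ := exists_contMDiffSection_eq (F := E) (I := I) v
  have hZ : SmoothField Z := Z.contMDiff
  have jacobi := congrFun (jacobi_mlieBracket hX hY hZ) x
  have jacobi_smul := congrFun (jacobi_mlieBracket hX hY (hZ.smul hc)) x
  rw [mlieBracket_smul (X := mlieBracket I X Y) hc hZ, Pi.add_apply,
    mlieBracket_mlieBracket_smul hc hY hZ, mlieBracket_mlieBracket_smul hc hX hZ] at jacobi_smul
  simp only [Pi.add_apply, Pi.smul_apply'] at jacobi jacobi_smul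
  rw [jacobi] at jacobi_smul
  refine sub_eq_zero.1 ((smul_eq_zero.1 (?_ : _ • Z x = 0)).resolve_right hv)
  linear_combination (norm := module) -jacobi_smul

end SmoothField

section Model

variable {E : Type*} [NormedAddCommGroup E] [NormedSpace ℝ E]
  {H : Type*} [TopologicalSpace H] {I : ModelWithCorners ℝ E H}
  {M : Type*} [TopologicalSpace M] [ChartedSpace H M] [IsManifold I ∞ M]

variable (I M) in
/-- The space of smooth vector fields on `M`. -/
abbrev SmoothFields := Cₛ^∞⟮I; E, (TangentSpace I : M → Type _)⟯

variable (I M) in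
/-- The space of smooth real functions on `M`. -/
abbrev SmoothFunctions := C^∞⟮I, M; ℝ⟯

instance SmoothField.canLift :
    CanLift (Π x : M, TangentSpace I x) (SmoothFields I M) (⇑) SmoothField where
  prf X hX := ⟨⟨X, hX⟩, rfl⟩

/-- The endomorphism of the space of smooth vector fields given by a smooth `(1,1)`-tensor field. -/
def SmoothEndField.toEnd {T : EndField I M} (hT : SmoothEndField T) :
    Module.End ℝ (SmoothFields I M) where
  toFun X := ⟨T.app X, SmoothField.app hT X.contMDiff⟩
  map_add' X Y := by ext x; exact map_add (T x) (X x) (Y x)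
  map_smul' a X := by ext x; exact map_smul (T x) a (X x)

lemma SmoothEndField.coe_toEnd {T : EndField I M} (hT : SmoothEndField T) (X : SmoothFields I M) :
    ⇑(hT.toEnd X) = T.app X := rfl

/-- The derivation of the space of smooth functions given by a smooth vector field. -/
def lieDer (X : SmoothFields I M) : SmoothFunctions I M →ₗ[ℝ] SmoothFunctions I M where
  toFun c := ⟨fun x ↦ d% c x (X x), SmoothField.contMDiff_mvfderiv X.contMDiff c.contMDiff⟩
  map_add' c c' := by
    ext x
    have := mvfderiv_add ((c.contMDiff x).mdifferentiableAt (by simp))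
      ((c'.contMDiff x).mdifferentiableAt (by simp))
    exact congrArg (fun A : TangentSpace I x →L[ℝ] ℝ ↦ A (X x)) this
  map_smul' a c := by
    ext x
    change d% (fun y ↦ a * c y) x (X x) = a * d% c x (X x)
    rw [mvfderiv_fun_mul mdifferentiableAt_const ((c.contMDiff x).mdifferentiableAt (by simp)),
      mvfderiv_const]
    simp

/-- The metric, as a bilinear map from smooth vector fields to smooth functions. -/
def metricForm (g : ContMDiffRiemannianMetric I ∞ E (fun x : M ↦ TangentSpace I x)) :
    SmoothFields I M →ₗ[ℝ] SmoothFields I M →ₗ[ℝ] SmoothFunctions I M :=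
  LinearMap.mk₂ ℝ
    (fun X Y ↦ ⟨fun x ↦ g.inner x (X x) (Y x), fun x ↦
      contMDiffAt_metric g (X.contMDiff x) (Y.contMDiff x)⟩)
    (fun X X' Y ↦ by ext x; simp; rfl) (fun a X Y ↦ by ext x; simp; rfl)
    (fun X Y Y' ↦ by ext x; simp; rfl) (fun a X Y ↦ by ext x; simp; rfl)

variable [FiniteDimensional ℝ E]
  (g : ContMDiffRiemannianMetric I ∞ E (fun x : M ↦ TangentSpace I x))
  {X Y Y' : Π x : M, TangentSpace I x}

lemma nabla_sub_nabla (hX : SmoothField X) (hY : SmoothField Y) :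
    nabla g X Y - nabla g Y X = mlieBracket I X Y := by
  ext x
  exact leviCivita_torsion_free g (hX.mdiffAt x) (hY.mdiffAt x)

lemma nabla_add_right (hY : SmoothField Y) (hY' : SmoothField Y') :
    nabla g X (Y + Y') = nabla g X Y + nabla g X Y' := by
  ext x
  have := (leviCivita g).isCovariantDerivativeOnUniv.add (hY.mdiffAt x) (hY'.mdiffAt x)
  exact congrArg (fun A : TangentSpace I x →L[ℝ] TangentSpace I x ↦ A (X x)) this

lemma nabla_smul_right (a : ℝ) (hY : SmoothField Y) :
    nabla g X (a • Y) = a • nabla g X Y := by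
  ext x
  have := (leviCivita g).isCovariantDerivativeOnUniv.smul_const (a := a) (hY.mdiffAt x)
  exact congrArg (fun A : TangentSpace I x →L[ℝ] TangentSpace I x ↦ A (X x)) this

/-- The Levi-Civita connection, acting on the space of smooth vector fields. -/
def nablaEndHom : SmoothFields I M →ₗ[ℝ] Module.End ℝ (SmoothFields I M) :=
  LinearMap.mk₂ ℝ (fun X Y ↦ ⟨nabla g X Y, SmoothField.nabla g X.contMDiff Y.contMDiff⟩)
    (fun X X' Y ↦ by ext x; exact map_add (leviCivita g Y x) (X x) (X' x))
    (fun a X Y ↦ by ext x; exact map_smul (leviCivita g Y x) a (X x))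
    (fun X Y Y' ↦ by ext x; exact congrFun (nabla_add_right g Y.contMDiff Y'.contMDiff) x)
    (fun a X Y ↦ by ext x; exact congrFun (nabla_smul_right g a Y.contMDiff) x)

/-- The `LeviCivitaModel` of a Riemannian manifold. -/
def leviCivitaModel [T2Space M] : LeviCivitaModel ℝ (SmoothFields I M) (SmoothFunctions I M) where
  met := metricForm g
  der := lieDer
  con := nablaEndHom g
  met_symm X Y := by ext x; exact g.symm x _ _
  met_definite X hX := by
    ext x
    by_contra hne
    exact (g.pos x _ hne).ne' (congrArg (fun c : SmoothFunctions I M ↦ c x) hX)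
  der_met X Y Z := by
    ext x
    exact leviCivita_metric g X.mdifferentiableAt Y.mdifferentiableAt Z.mdifferentiableAt
  der_bracket X Y c := by
    ext x
    have h := mvfderiv_mlieBracket c.contMDiff X.contMDiff Y.contMDiff x
    rw [← nabla_sub_nabla g X.contMDiff Y.contMDiff] at h
    exact h
  jacobi X Y Z := by
    have h := jacobi_mlieBracket X.contMDiff Y.contMDiff Z.contMDiff
    rw [← nabla_sub_nabla g X.contMDiff (SmoothField.mlieBracket Y.contMDiff Z.contMDiff),
      ← nabla_sub_nabla g Y.contMDiff (SmoothField.mlieBracket X.contMDiff Z.contMDiff),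
      ← nabla_sub_nabla g (SmoothField.mlieBracket X.contMDiff Y.contMDiff) Z.contMDiff,
      ← nabla_sub_nabla g X.contMDiff Y.contMDiff, ← nabla_sub_nabla g X.contMDiff Z.contMDiff,
      ← nabla_sub_nabla g Y.contMDiff Z.contMDiff] at h
    ext x
    exact congrFun h x

variable {g}

lemma curvature_eq [T2Space M] (X Y Z : SmoothFields I M) :
    curvature g X Y Z = (leviCivitaModel g).curv X Y Z := by
  rw [curvature, ← nabla_sub_nabla g X.contMDiff Y.contMDiff]
  rfl

variable {n s : ℕ} {f Q : EndField I M} {ξ : Fin s → Π x : M, TangentSpace I x}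
  {η : Fin s → Π x : M, TangentSpace I x →L[ℝ] ℝ}

namespace IsWeakMetricFStructure

variable (h : IsWeakMetricFStructure g n s f Q ξ η)

include h

omit [FiniteDimensional ℝ E] in
lemma f_ξ (x : M) (i : Fin s) : f x (ξ i x) = 0 := by
  by_contra hne
  refine (g.pos x _ hne).ne' ?_
  rw [h.metric_f]
  simp [h.Q_ξ, h.orthonormal_ξ, h.η_ξ]

omit [FiniteDimensional ℝ E] in
lemma η_eq (x : M) (i : Fin s) (v : TangentSpace I x) : η i x v = g.inner x v (ξ i x) := by
  have hmetric := h.metric_f x v (ξ i x)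
  rw [h.f_ξ, map_zero, h.Q_ξ] at hmetric
  simp only [h.η_ξ, mul_ite, mul_one, mul_zero, Finset.sum_ite_eq', Finset.mem_univ,
    if_true] at hmetric
  exact (sub_eq_zero.1 hmetric.symm).symm

/-- The projection `∑ i, η i ⊗ ξ i` of the smooth vector fields onto the span of the characteristic
fields, written as `f² + Q`. -/
def proj : Module.End ℝ (SmoothFields I M) :=
  h.smooth_f.toEnd * h.smooth_f.toEnd + h.smooth_Q.toEnd

omit [FiniteDimensional ℝ E] in
lemma proj_apply (X : SmoothFields I M) (x : M) : h.proj X x = ∑ i, η i x (X x) • ξ i x := by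
  have : h.proj X x = f x (f x (X x)) + Q x (X x) := rfl
  rw [this, h.f_sq]
  abel

omit [FiniteDimensional ℝ E] in
lemma inContact_iff (X : SmoothFields I M) : InContact η X ↔ h.proj X = 0 := by
  refine ⟨fun hX ↦ ?_, fun hX x i ↦ ?_⟩
  · ext x
    rw [h.proj_apply]
    exact Finset.sum_eq_zero fun i _ ↦ by rw [hX x i, zero_smul]
  · have hproj : η i x (h.proj X x) = η i x (X x) := by simp [h.proj_apply, h.η_ξ]
    rw [← hproj, hX]
    exact map_zero _

/-- The characteristic fields `ξ i`, as smooth vector fields. -/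
def charField (i : Fin s) : SmoothFields I M := ⟨ξ i, h.smooth_ξ i⟩

omit [FiniteDimensional ℝ E] in
lemma coe_charField (i : Fin s) : ⇑(h.charField i) = ξ i := rfl

end IsWeakMetricFStructure

namespace IsWeakNearlyC

variable [T2Space M] (h : IsWeakNearlyC g n s f Q ξ η)

include h

lemma model : WeakNearlyCModel (leviCivitaModel g) h.smooth_f.toEnd h.smooth_Q.toEnd h.proj
    h.charField where
  isSkewAdjoint_F X Y := by
    ext x
    exact (h.skew_f x _ _).trans (map_neg (g.inner x (X x)) _).symm
  nearly X Y := by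
    rw [← add_eq_zero_iff_eq_neg]
    ext x
    exact congrFun (h.nearly X Y X.contMDiff Y.contMDiff) x
  isSelfAdjoint_Q X Y := by ext x; exact h.selfAdjoint_Q x _ _
  injective_Q X Y hXY := by
    ext x
    exact (h.nonsingular_Q x).1 (congrArg (fun Z : SmoothFields I M ↦ Z x) hXY)
  F_mul_F := by simp [IsWeakMetricFStructure.proj]
  F_mul_P := by
    ext X x
    change f x (h.proj X x) = 0
    simp [h.proj_apply, h.f_ξ]
  Q_mul_P := by
    ext X x
    change Q x (h.proj X x) = h.proj X x
    simp [h.proj_apply, h.Q_ξ]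
  P_ξ i := by
    ext x
    rw [h.proj_apply]
    change ∑ j, η j x (ξ i x) • ξ j x = ξ i x
    simp [h.η_ξ]
  P_eq_zero_iff X := by
    rw [← h.inContact_iff]
    refine ⟨fun hX i ↦ ?_, fun hX x i ↦ ?_⟩
    · ext x
      exact (h.η_eq x i _).symm.trans (hX x i)
    · rw [h.η_eq]
      exact congrArg (fun c : SmoothFunctions I M ↦ c x) (hX i)
  der_met_ξ X i j := by
    ext x
    change d% (fun y ↦ g.inner y (ξ i y) (ξ j y)) x (X x) = 0
    simp only [h.orthonormal_ξ, mvfderiv_const]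
    rfl

lemma commute_con_Q (hQ : QParallelOnContact g Q η) (X : SmoothFields I M) :
    Commute ((leviCivitaModel g).con X) h.smooth_Q.toEnd :=
  h.model.commute_con_Q (fun X Y hY ↦ by
    ext x
    exact congrFun (hQ X Y X.contMDiff Y.contMDiff ((h.inContact_iff Y).2 hY)) x) X

lemma con_charField_comm (comm : ∀ i j, mlieBracket I (ξ i) (ξ j) = 0) (i j : Fin s) :
    (leviCivitaModel g).con (h.charField i) (h.charField j)
      = (leviCivitaModel g).con (h.charField j) (h.charField i) := by
  rw [← sub_eq_zero]
  ext x
  have := nabla_sub_nabla g (h.smooth_ξ i) (h.smooth_ξ j)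
  rw [comm] at this
  exact congrFun this x

open LeviCivitaModel in
lemma curv_charField_eq_zero (hQ : QParallelOnContact g Q η)
    (comm : ∀ i j, mlieBracket I (ξ i) (ξ j) = 0) (i j : Fin s) :
    (leviCivitaModel g).curv (h.charField i) (h.charField j) = 0 := by
  have hQ' := h.commute_con_Q hQ
  have hcomm := h.con_charField_comm comm
  rw [h.model.curv_ξ_ξ_eq hcomm hQ']
  ext X x
  let _ : RiemannianBundle (fun x : M ↦ TangentSpace I x) := ⟨g.toRiemannianMetric⟩
  let c (i : Fin s) : Module.End ℝ (TangentSpace I x) :=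
    (f x ∘L f x ∘L leviCivita g (ξ i) x).toLinearMap
  have hc (i : Fin s) : LinearMap.adjoint (c i) = -c i := by
    refine ((LinearMap.eq_adjoint_iff _ _).2 fun v w ↦ ?_).symm
    obtain ⟨X, rfl⟩ := exists_contMDiffSection_eq (F := E) (I := I) v
    obtain ⟨Y, rfl⟩ := exists_contMDiffSection_eq (F := E) (I := I) w
    rw [LinearMap.neg_apply, inner_neg_left]
    have := congrArg (fun c : SmoothFunctions I M ↦ c x)
      (met_apply_of_isSkewAdjoint (h.model.isSkewAdjoint_contactShape hQ' i) X Y)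
    exact neg_eq_iff_eq_neg.2 this
  have hcc : ⁅⁅c i, c j⁆, c i⁆ = 0 := LinearMap.ext fun v ↦ by
    obtain ⟨X, rfl⟩ := exists_contMDiffSection_eq (F := E) (I := I) v
    exact congrArg (fun Y : SmoothFields I M ↦ Y x)
      (DFunLike.congr_fun (h.model.lie_lie_contactShape hcomm hQ' i j i) X)
  have := DFunLike.congr_fun (lie_eq_zero_of_lie_lie_eq_zero (hc i) (hc j) hcc) (X x)
  exact (congrArg ((-2 : ℝ) • ·) this).trans (smul_zero _)

/-! ### The curvature of a weak nearly `C`-manifold -/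

variable {X Y Z V : Π x : M, TangentSpace I x}

theorem inner_curvature_derivation (hX : SmoothField X) (hY : SmoothField Y)
    (hZ : SmoothField Z) (hV : SmoothField V) (x : M) :
    g.inner x (curvature g (f.app X) Y Z x) (V x)
      + g.inner x (curvature g X (f.app Y) Z x) (V x)
      + g.inner x (curvature g X Y (f.app Z) x) (V x)
      + g.inner x (curvature g X Y Z x) (f.app V x) = 0 := by
  lift X to SmoothFields I M using hX
  lift Y to SmoothFields I M using hY
  lift Z to SmoothFields I M using hZ
  lift V to SmoothFields I M using hV
  rw [← h.smooth_f.coe_toEnd, ← h.smooth_f.coe_toEnd, ← h.smooth_f.coe_toEnd,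
    ← h.smooth_f.coe_toEnd]
  simp only [curvature_eq]
  exact congrArg (fun c : SmoothFunctions I M ↦ c x)
    (LeviCivitaModel.derivCurv_eq_zero h.model.isSkewAdjoint_F h.model.nearly X Y Z V)

lemma proj_curv_eq_zero (hC : QCurvatureInvariant g Q η) (X Y Z : SmoothFields I M)
    (hX : h.proj X = 0) (hY : h.proj Y = 0) (hZ : h.proj Z = 0) :
    h.proj ((leviCivitaModel g).curv X Y Z) = 0 := by
  refine h.model.P_curv_eq_zero (fun X Y Z hX hY hZ ↦ ?_) hX hY hZ
  rw [← h.inContact_iff] at hX hY hZ ⊢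
  rw [← curvature_eq]
  exact hC X Y Z X.contMDiff Y.contMDiff Z.contMDiff hX hY hZ

theorem contactCurvatureInvariant (hC : QCurvatureInvariant g Q η) :
    ContactCurvatureInvariant g η := by
  intro X Y Z hX hY hZ hXD hYD hZD
  lift X to SmoothFields I M using hX
  lift Y to SmoothFields I M using hY
  lift Z to SmoothFields I M using hZ
  rw [h.inContact_iff] at hXD hYD hZD
  rw [curvature_eq, h.inContact_iff]
  exact h.proj_curv_eq_zero hC X Y Z hXD hYD hZD

theorem inner_curvature_ξ_f_f_eq_zero (hC : QCurvatureInvariant g Q η) (i : Fin s)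
    (hX : SmoothField X) (hY : SmoothField Y) (hZ : SmoothField Z) (hZD : InContact η Z) (x : M) :
    g.inner x (curvature g (ξ i) Z (f.app X) x) (f.app Y x) = 0 := by
  lift X to SmoothFields I M using hX
  lift Y to SmoothFields I M using hY
  lift Z to SmoothFields I M using hZ
  rw [h.inContact_iff] at hZD
  rw [← h.coe_charField, ← h.smooth_f.coe_toEnd, ← h.smooth_f.coe_toEnd, curvature_eq]
  exact congrArg (fun c : SmoothFunctions I M ↦ c x)
    (h.model.met_curv_ξ_F_F_eq_zero (h.proj_curv_eq_zero hC) i X Y hZD)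

theorem curvature_ξ_ξ_eq_zero (hQ : QParallelOnContact g Q η)
    (comm : ∀ i j, mlieBracket I (ξ i) (ξ j) = 0) (i j : Fin s) (hZ : SmoothField Z) :
    curvature g (ξ i) (ξ j) Z = 0 := by
  lift Z to SmoothFields I M using hZ
  rw [← h.coe_charField, ← h.coe_charField, curvature_eq, h.curv_charField_eq_zero hQ comm]
  rfl

theorem inner_curvature_ξ_f_f_eq_zero_of_commuting (hQ : QParallelOnContact g Q η)
    (hC : QCurvatureInvariant g Q η) (comm : ∀ i j, mlieBracket I (ξ i) (ξ j) = 0) (i : Fin s)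
    (hX : SmoothField X) (hY : SmoothField Y) (hZ : SmoothField Z) (x : M) :
    g.inner x (curvature g (ξ i) Z (f.app X) x) (f.app Y x) = 0 := by
  lift X to SmoothFields I M using hX
  lift Y to SmoothFields I M using hY
  lift Z to SmoothFields I M using hZ
  rw [← h.coe_charField, ← h.smooth_f.coe_toEnd, ← h.smooth_f.coe_toEnd, curvature_eq]
  exact congrArg (fun c : SmoothFunctions I M ↦ c x)
    (h.model.met_curv_ξ_F_F_eq_zero_of_curv_ξ_ξ (h.proj_curv_eq_zero hC)
      (h.curv_charField_eq_zero hQ comm) i X Y Z)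

end IsWeakNearlyC
end Model

end WeakNearlyC

end

open WeakNearlyC in
theorem mainTheorem7_general
    {E : Type*} [NormedAddCommGroup E] [NormedSpace ℝ E] [FiniteDimensional ℝ E]
    {H : Type*} [TopologicalSpace H] {I : ModelWithCorners ℝ E H}
    {M : Type*} [TopologicalSpace M] [T2Space M] [ChartedSpace H M] [IsManifold I ∞ M]
    (g : ContMDiffRiemannianMetric I ∞ E (fun x : M ↦ TangentSpace I x))
    (n s : ℕ) (f Q : EndField I M) (ξ : Fin s → Π x : M, TangentSpace I x)
    (η : Fin s → Π x : M, TangentSpace I x →L[ℝ] ℝ) (h : IsWeakNearlyC g n s f Q ξ η) :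
    (∀ X Y Z V : Π x : M, TangentSpace I x,
      SmoothField X → SmoothField Y → SmoothField Z → SmoothField V → ∀ x : M,
        g.inner x (curvature g (f.app X) Y Z x) (V x)
          + g.inner x (curvature g X (f.app Y) Z x) (V x)
          + g.inner x (curvature g X Y (f.app Z) x) (V x)
          + g.inner x (curvature g X Y Z x) (f.app V x) = 0) ∧
    (QCurvatureInvariant g Q η →
      (∀ j, ∀ X Y Z : Π x : M, TangentSpace I x,
        SmoothField X → SmoothField Y → SmoothField Z → InContact η Z → ∀ x : M,
          g.inner x (curvature g (ξ j) Z (f.app X) x) (f.app Y x) = 0) ∧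
      ContactCurvatureInvariant g η) ∧
    (QParallelOnContact g Q η → (∀ i j, mlieBracket I (ξ i) (ξ j) = 0) →
      (∀ j k, ∀ Z : Π x : M, TangentSpace I x, SmoothField Z →
        curvature g (ξ j) (ξ k) Z = 0) ∧
      (QCurvatureInvariant g Q η →
        ∀ j, ∀ X Y Z : Π x : M, TangentSpace I x,
          SmoothField X → SmoothField Y → SmoothField Z → ∀ x : M,
            g.inner x (curvature g (ξ j) Z (f.app X) x) (f.app Y x) = 0)) :=
  ⟨fun _ _ _ _ hX hY hZ hV ↦ h.inner_curvature_derivation hX hY hZ hV,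
    fun hC ↦ ⟨fun j _ _ _ hX hY hZ ↦ h.inner_curvature_ξ_f_f_eq_zero hC j hX hY hZ,
      h.contactCurvatureInvariant hC⟩,
    fun hQ comm ↦ ⟨fun j k _ hZ ↦ h.curvature_ξ_ξ_eq_zero hQ comm j k hZ,
      fun hC j _ _ _ hX hY hZ ↦
        h.inner_curvature_ξ_f_f_eq_zero_of_commuting hQ hC comm j hX hY hZ⟩⟩

open WeakNearlyC in
theorem mainTheorem7
    {E : Type*} [NormedAddCommGroup E] [NormedSpace ℝ E] [FiniteDimensional ℝ E]
    {M : Type*} [TopologicalSpace M] [T2Space M]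
    [ChartedSpace E M] [IsManifold 𝓘(ℝ, E) ∞ M]
    (g : ContMDiffRiemannianMetric 𝓘(ℝ, E) ∞ E (fun x : M ↦ TangentSpace 𝓘(ℝ, E) x))
    (n s : ℕ) (f Q : EndField 𝓘(ℝ, E) M)
    (ξ : Fin s → Π x : M, TangentSpace 𝓘(ℝ, E) x)
    (η : Fin s → Π x : M, TangentSpace 𝓘(ℝ, E) x →L[ℝ] ℝ)
    (h : IsWeakNearlyC g n s f Q ξ η) :
    (∀ X Y Z V : Π x : M, TangentSpace 𝓘(ℝ, E) x,
      SmoothField X → SmoothField Y → SmoothField Z → SmoothField V → ∀ x : M,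
        g.inner x (curvature g (f.app X) Y Z x) (V x)
          + g.inner x (curvature g X (f.app Y) Z x) (V x)
          + g.inner x (curvature g X Y (f.app Z) x) (V x)
          + g.inner x (curvature g X Y Z x) (f.app V x) = 0) ∧
    (QParallelOnContact g Q η → QCurvatureInvariant g Q η →
      (∀ j, ∀ X Y Z : Π x : M, TangentSpace 𝓘(ℝ, E) x,
        SmoothField X → SmoothField Y → SmoothField Z → InContact η Z → ∀ x : M,
          g.inner x (curvature g (ξ j) Z (f.app X) x) (f.app Y x) = 0) ∧
      ContactCurvatureInvariant g η ∧
      ((∀ i j, mlieBracket 𝓘(ℝ, E) (ξ i) (ξ j) = 0) →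
        (∀ j k, ∀ Z : Π x : M, TangentSpace 𝓘(ℝ, E) x, SmoothField Z →
          curvature g (ξ j) (ξ k) Z = 0) ∧
        (∀ j, ∀ X Y Z : Π x : M, TangentSpace 𝓘(ℝ, E) x,
          SmoothField X → SmoothField Y → SmoothField Z → ∀ x : M,
            g.inner x (curvature g (ξ j) Z (f.app X) x) (f.app Y x) = 0))) := by
  obtain ⟨hA, hcontact, hcomm⟩ := mainTheorem7_general g n s f Q ξ η h
  exact ⟨hA, fun hQ hC ↦ ⟨(hcontact hC).1, (hcontact hC).2,
    fun comm ↦ ⟨(hcomm hQ comm).1, (hcomm hQ comm).2 hC⟩⟩⟩
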